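/- Let $p\ge 0$, let $(Z_t)_{t\in\mathbb Z}$ be independent identically distributed random variables with $\mathbb E Z_t=0$, $\mathbb E Z_t^2=1$, such that $Z_0^2$ is not almost surely constant. Let $a_0,\dots,a_p$ be real functions on $(0,1]$ and let $\{X_{t,N}:t=1,\dots,N\}$, $N\ge1$, be a time-varying ARCH($p$) process, that is, $$X_{t,N}=\sigma_{t,N}Z_t,\qquad \sigma_{t,N}\ge 0,\qquad \sigma_{t,N}^2=a_0\!\left(\tfrac tN\right)+\sum_{j=1}^p a_j\!\left(\tfrac tN\right)X_{t-j,N}^2\qquad\text{a.s. for }t=1,\dots,N,$$ which is causal (up to null sets, $X_{t,N}$ is a function of $(Z_s)_{s\le t}$, for $1-p\le t\le N$) and whose pre-sample values satisfy $\sup_{N\ge1}\max_{1-p\le t\le 0}\mathbb E X_{t,N}^2<\infty$ (for instance, $X_{t,N}=0$ for $t\le 0$). Assume: (1) There are constants $0<\rho,Q,M<\infty$, $0<\nu<1$ and a positive sequence $(\ell(j))_{j\ge0}$ with $\sum_{j\ge1}j/\ell(j)<\infty$ and $Q\sum_{j\ge1}1/\ell(j)\le 1-\nu$ such that, for all $u,v\in(0,1]$,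 $a_0(u)>\rho$, $a_j(u)\le Q/\ell(j)$ for $1\le j\le p$, and $|a_j(u)-a_j(v)|\le M|u-v|/\ell(j)$ for $0\le j\le p$. (2) For some $0<\rho_1\le\rho_2<\infty$ and $$\Omega=\Big\{(\alpha_0,\dots,\alpha_p):\ \sum_{j=1}^p\alpha_j\le1,\ \rho_1\le\alpha_0\le\rho_2,\ \rho_1\le\alpha_j\ (1\le j\le p)\Big\},$$ the vector $\mathbf a(u)=(a_0(u),\dots,a_p(u))$ lies in the interior of $\Omega$ for every $u\in(0,1]$. Let $W:[-1/2,1/2]\to\mathbb R$ be of bounded variation with $\int_{-1/2}^{1/2}W(x)\,dx=1$ and $\int_{-1/2}^{1/2}xW(x)\,dx=0$, extended by $0$ to $\mathbb R$. Let $u_0\in(0,1)$, let $t_0=t_0(N)\in\mathbb N$ satisfy $|u_0-t_0/N|<1/N$, and let the bandwidth $b=b(N)$ satisfy $b\to0$ and $bN\to\infty$ as $N\to\infty$. Let $\hat{\mathbf a}_{t_0,N}$ be, almost surely, any minimizer over $\alpha\in\Omega$ of $$\mathcal L_{t_0,N}(\alpha)=\sum_{k=p+1}^N\frac1{bN}W\!\left(\frac{t_0-k}{bN}\right)\frac12\left(\log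 w_{k,N}(\alpha)+\frac{X_{k,N}^2}{w_{k,N}(\alpha)}\right),\qquad w_{k,N}(\alpha)=\alpha_0+\sum_{j=1}^p\alpha_jX_{k-j,N}^2 .$$ Then $\hat{\mathbf a}_{t_0,N}\to\mathbf a(u_0)$ in probability as $N\to\infty$. -/

import Mathlib

open MeasureTheory ProbabilityTheory Filter Topology Set

noncomputable section

namespace TvARCH

/-- The innovations `Z_t`, `t ∈ ℤ`: independent, identically distributed, with mean `0` and
variance `1`. -/
structure IsInnovation {S : Type*} [MeasurableSpace S] (P : Measure S) (Z : ℤ → S → ℝ) :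
    Prop where
  measurable : ∀ t, Measurable (Z t)
  indep : iIndepFun Z P
  identDistrib : ∀ t, IdentDistrib (Z t) (Z 0) P P
  memLp : ∀ t, MemLp (Z t) 2 P
  mean : ∀ t, ∫ ω, Z t ω ∂P = 0
  secondMoment : ∀ t, ∫ ω, Z t ω ^ 2 ∂P = 1

/-- The σ-algebra generated by the innovations up to and including time `t`. -/
@[reducible]
def past {S : Type*} (Z : ℤ → S → ℝ) (t : ℤ) : MeasurableSpace S :=
  ⨆ s : Iic t, MeasurableSpace.comap (Z s) inferInstance

/-- `x N t` stands for `X_{t,N}`. For a parameter vector `α = (α_0, …, α_p)`, this is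
`w_{t,N}(α) = α_0 + ∑_{j=1}^p α_j X_{t-j,N}²`. -/
def condVar {p : ℕ} (α : Fin (p + 1) → ℝ) (x : ℕ → ℤ → ℝ) (N : ℕ) (t : ℤ) : ℝ :=
  α 0 + ∑ j : Fin p, α j.succ * x N (t - ((j : ℤ) + 1)) ^ 2

/-- `{X_{t,N} : t = 1, …, N}`, `N ≥ 1`, is a time-varying ARCH(p) process with innovations `Z` and
coefficient functions `a_0, …, a_p`: it solves
`X_{t,N} = σ_{t,N} Z_t`, `σ_{t,N}² = a_0(t/N) + ∑_{j=1}^p a_j(t/N) X_{t-j,N}²` for `1 ≤ t ≤ N`,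
and it is causal.

The recursion also involves the pre-sample values `X_{t,N}`, `1 - p ≤ t ≤ 0`. They are allowed to be
arbitrary up to causality and a second moment bounded in `N`; this covers zero pre-sample values and
also the causal solutions obtained by extending the coefficients to negative times. -/
structure IsTvARCH {S : Type*} [MeasurableSpace S] (P : Measure S) (Z : ℤ → S → ℝ) {p : ℕ}
    (a : Fin (p + 1) → ℝ → ℝ) (X : ℕ → ℤ → S → ℝ) : Prop where
  recursion : ∀ (N : ℕ) (t : ℤ), 1 ≤ t → t ≤ N → ∀ᵐ ω ∂P,
    X N t ω =
      Real.sqrt (condVar (fun j => a j ((t : ℝ) / N)) (fun n s => X n s ω) N t) * Z t ω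
  causal : ∀ (N : ℕ) (t : ℤ), 1 ≤ N → 1 - (p : ℤ) ≤ t → t ≤ N →
    AEStronglyMeasurable[past Z t] (X N t) P
  presample : ∃ C : ℝ, ∀ (N : ℕ) (t : ℤ), 1 ≤ N → 1 - (p : ℤ) ≤ t → t ≤ 0 →
    Integrable (fun ω => X N t ω ^ 2) P ∧ ∫ ω, X N t ω ^ 2 ∂P ≤ C

/-- The conditions on the coefficient functions `a_0, …, a_p` on rescaled time `(0, 1]`: `a_0` is
bounded away from zero, the `a_j` are bounded and Lipschitz with constants that decay like
`1 / ℓ(j)`, and the bounds of `a_1, …, a_p` add up to less than one. The Lipschitz condition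
includes `j = 0`; as `M` is arbitrary, the value of `ℓ(0)` is irrelevant. -/
def RegularCoeffs {p : ℕ} (a : Fin (p + 1) → ℝ → ℝ) : Prop :=
  ∃ (ρ Q M ν : ℝ) (ℓ : ℕ → ℝ),
    0 < ρ ∧ 0 < Q ∧ 0 < M ∧ 0 < ν ∧ ν < 1 ∧ (∀ j, 0 < ℓ j) ∧
    (∀ u ∈ Ioc (0 : ℝ) 1, ρ < a 0 u) ∧
    (∀ j : Fin p, ∀ u ∈ Ioc (0 : ℝ) 1, a j.succ u ≤ Q / ℓ ((j : ℕ) + 1)) ∧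
    (Q * ∑' j : ℕ, 1 / ℓ (j + 1) ≤ 1 - ν) ∧
    (∀ j : Fin (p + 1), ∀ u ∈ Ioc (0 : ℝ) 1, ∀ v ∈ Ioc (0 : ℝ) 1,
      |a j u - a j v| ≤ M * |u - v| / ℓ j) ∧
    Summable (fun j : ℕ => (j : ℝ) / ℓ j)

/-- The compact parameter set. -/
def paramSet (p : ℕ) (ρ₁ ρ₂ : ℝ) : Set (Fin (p + 1) → ℝ) :=
  {α | ∑ j : Fin p, α j.succ ≤ 1 ∧ ρ₁ ≤ α 0 ∧ α 0 ≤ ρ₂ ∧ ∀ j : Fin p, ρ₁ ≤ α j.succ}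

/-- The conditions on the kernel `W : [-1/2, 1/2] → ℝ`. -/
structure IsKernel (W : ℝ → ℝ) : Prop where
  boundedVariation : BoundedVariationOn W (Icc (-1 / 2) (1 / 2))
  integral_eq_one : ∫ x in (-1 / 2 : ℝ)..(1 / 2), W x = 1
  integral_mul_eq_zero : ∫ x in (-1 / 2 : ℝ)..(1 / 2), x * W x = 0

/-- The conditional quasi-likelihood
`ℓ_{k,N}(α) = (log w_{k,N}(α) + X_{k,N}² / w_{k,N}(α)) / 2`. -/
def quasiLik {p : ℕ} (x : ℕ → ℤ → ℝ) (N : ℕ) (k : ℤ) (α : Fin (p + 1) → ℝ) : ℝ :=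
  (1 / 2) * (Real.log (condVar α x N k) + x N k ^ 2 / condVar α x N k)

/-- The kernel-weighted quasi-likelihood
`L_{t₀,N}(α) = ∑_{k=p+1}^N (bN)⁻¹ W((t₀ - k)/(bN)) ℓ_{k,N}(α)`, with the kernel set to zero outside
`[-1/2, 1/2]`. -/
def weightedLik {p : ℕ} (W : ℝ → ℝ) (b : ℝ) (t₀ : ℕ) (x : ℕ → ℤ → ℝ) (N : ℕ)
    (α : Fin (p + 1) → ℝ) : ℝ :=
  ∑ k ∈ Finset.Icc (p + 1) N,
    1 / (b * N) * (Icc (-1 / 2 : ℝ) (1 / 2)).indicator W (((t₀ : ℝ) - k) / (b * N)) *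
      quasiLik x N (k : ℤ) α

end TvARCH

end

noncomputable section

namespace TvARCH

/-! This is the classical argument for minimum contrast estimators. Near `t₀` the process looks like
the stationary ARCH process with coefficients frozen at `u₀`, so the kernel-weighted
quasi-likelihood converges to `meanLik P Z β`, the stationary mean quasi-likelihood with `β =
a(u₀)`. That limit has `β` as its unique minimizer over the compact set Ω, and convergence that is
uniform in probability carries the minimizers along.

Identification (`IsInnovation.meanLik_lt`): conditionally on the past, the contrast has the form log
w + σ²/w, minimal only at w = σ². If two parameters gave the same conditional variance, the most
recent lag at which they differ could be solved for, making some Z_t² a function of the past and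
hence constant.

Convergence (`IsTvARCH.tendsto_integral_abs_weightedLik_sub`): the stationary process is replaced by
its m-th Picard iterate, which depends on finitely many innovations. Its quasi-likelihoods are then
identically distributed with finite-range dependence, so covariances and truncation give a weighted
law of large numbers without any ergodic theorem. The replacement costs A^m plus a drift term of the
order of the distance in rescaled time, because the ARCH recursion contracts in L¹ with factor A < 1
(`IsTvARCH.integral_abs_sq_sub_picard_le`).

Only second moments of X exist. They suffice because every parameter lies in [ρ₁, R] with ρ₁ > 0:
all the functions w(α) are comparable to 1 + ΣX², so their ratios are bounded and the contrast is
Lipschitz in the squares, up to the factor 1 + Z_k², which is independent of the past. The contrast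
is also Lipschitz in α with an integrable constant (`abs_weightedLik_sub_le`), which turns pointwise
convergence into uniform control over a finite net. -/

/-- The affine function `v ↦ α₀ + ∑ⱼ αⱼ₊₁ vⱼ`. -/
def lin {p : ℕ} (α : Fin (p + 1) → ℝ) (v : Fin p → ℝ) : ℝ :=
  α 0 + ∑ j, α j.succ * v j

/-- The Gaussian quasi-likelihood of the squared observation `y` given squared past values `v`. -/
def qlik {p : ℕ} (α : Fin (p + 1) → ℝ) (y : ℝ) (v : Fin p → ℝ) : ℝ :=
  1 / 2 * (Real.log (lin α v) + y / lin α v)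

/-! ### Deterministic bounds for the quasi-likelihood. -/

section Deterministic

variable {p : ℕ} {ρ R : ℝ} {α β : Fin (p + 1) → ℝ} {v v' : Fin p → ℝ}

lemma mul_one_add_sum_le_lin (hα : ∀ j, α j ∈ Icc ρ R) (hv : ∀ j, 0 ≤ v j) :
    ρ * (1 + ∑ j, v j) ≤ lin α v := by
  rw [lin, mul_add, mul_one, Finset.mul_sum]
  exact add_le_add (hα 0).1
    (Finset.sum_le_sum fun j _ => mul_le_mul_of_nonneg_right (hα _).1 (hv j))

lemma lin_le_mul_one_add_sum (hα : ∀ j, α j ∈ Icc ρ R) (hv : ∀ j, 0 ≤ v j) :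
    lin α v ≤ R * (1 + ∑ j, v j) := by
  rw [lin, mul_add, mul_one, Finset.mul_sum]
  exact add_le_add (hα 0).2
    (Finset.sum_le_sum fun j _ => mul_le_mul_of_nonneg_right (hα _).2 (hv j))

lemma le_lin (hρ : 0 < ρ) (hα : ∀ j, α j ∈ Icc ρ R) (hv : ∀ j, 0 ≤ v j) :
    ρ ≤ lin α v := by
  refine le_trans ?_ (mul_one_add_sum_le_lin hα hv)
  have := Finset.sum_nonneg fun j (_ : j ∈ Finset.univ) => hv j
  nlinarith

lemma lin_pos (hρ : 0 < ρ) (hα : ∀ j, α j ∈ Icc ρ R) (hv : ∀ j, 0 ≤ v j) :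
    0 < lin α v :=
  hρ.trans_le (le_lin hρ hα hv)

lemma upper_pos (hρ : 0 < ρ) (hα : ∀ j, α j ∈ Icc ρ R) : 0 < R :=
  hρ.trans_le ((hα 0).1.trans (hα 0).2)

lemma lin_sub_lin (α : Fin (p + 1) → ℝ) (v v' : Fin p → ℝ) :
    lin α v - lin α v' = ∑ j, α j.succ * (v j - v' j) := by
  simp only [lin, mul_sub, Finset.sum_sub_distrib]
  ring

lemma abs_lin_sub_lin_le' (hα : ∀ j : Fin p, 0 ≤ α j.succ) (v v' : Fin p → ℝ) :
    |lin α v - lin α v'| ≤ ∑ j, α j.succ * |v j - v' j| := by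
  rw [lin_sub_lin]
  refine (Finset.abs_sum_le_sum_abs _ _).trans (Finset.sum_le_sum fun j _ => ?_)
  rw [abs_mul, abs_of_nonneg (hα j)]

lemma abs_lin_sub_lin_le (hρ : 0 < ρ) (hα : ∀ j, α j ∈ Icc ρ R) (v v' : Fin p → ℝ) :
    |lin α v - lin α v'| ≤ R * ∑ j, |v j - v' j| := by
  refine (abs_lin_sub_lin_le' (fun j => hρ.le.trans (hα _).1) v v').trans ?_
  rw [Finset.mul_sum]
  exact Finset.sum_le_sum fun j _ => mul_le_mul_of_nonneg_right (hα _).2 (abs_nonneg _)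

lemma abs_lin_sub_lin_param_le {δ : ℝ} (h : ∀ j, |α j - β j| ≤ δ) (hv : ∀ j, 0 ≤ v j) :
    |lin α v - lin β v| ≤ δ * (1 + ∑ j, v j) := by
  have : lin α v - lin β v = (α 0 - β 0) + ∑ j : Fin p, (α j.succ - β j.succ) * v j := by
    simp only [lin, sub_mul, Finset.sum_sub_distrib]
    ring
  rw [this, mul_add, mul_one, Finset.mul_sum]
  refine (abs_add_le _ _).trans (add_le_add (h 0) ?_)
  refine (Finset.abs_sum_le_sum_abs _ _).trans (Finset.sum_le_sum fun j _ => ?_)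
  rw [abs_mul, abs_of_nonneg (hv j)]
  exact mul_le_mul_of_nonneg_right (h _) (hv j)

/-- A bound on the relative error, rather than the absolute one, keeps the logarithm under control
however large the arguments are. It follows from log s ≤ s - 1 at s = x/y and s = y/x. -/
lemma abs_log_sub_log_le {x y c : ℝ} (hx : 0 < x) (hy : 0 < y) (hxc : |x - y| ≤ c * x)
    (hyc : |x - y| ≤ c * y) : |Real.log x - Real.log y| ≤ c := by
  have key : ∀ {x y : ℝ}, 0 < x → 0 < y → |x - y| ≤ c * y → Real.log x - Real.log y ≤ c := by
    intro x y hx hy h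
    rw [← Real.log_div hx.ne' hy.ne']
    refine (Real.log_le_sub_one_of_pos (div_pos hx hy)).trans ?_
    rw [sub_le_iff_le_add, div_le_iff₀ hy]
    linarith [le_abs_self (x - y)]
  rw [abs_le]
  constructor
  · have := key hy hx (by rwa [abs_sub_comm])
    linarith
  · exact key hx hy hyc

lemma abs_log_sub_log_le_div {x y : ℝ} (hρ : 0 < ρ) (hx : ρ ≤ x) (hy : ρ ≤ y) :
    |Real.log x - Real.log y| ≤ |x - y| / ρ := by
  have h : ∀ z, ρ ≤ z → |x - y| ≤ |x - y| / ρ * z := fun z hz => by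
    rw [div_mul_eq_mul_div, le_div_iff₀ hρ]
    exact mul_le_mul_of_nonneg_left hz (abs_nonneg _)
  exact abs_log_sub_log_le (hρ.trans_le hx) (hρ.trans_le hy) (h x hx) (h y hy)

/-- Both sides are comparable to 1 + Σv; this is where a positive lower bound on every coefficient
pays off. -/
lemma lin_div_lin_le (hρ : 0 < ρ) (hα : ∀ j, α j ∈ Icc ρ R) (hβ : ∀ j, β j ∈ Icc ρ R)
    (hv : ∀ j, 0 ≤ v j) : lin β v / lin α v ≤ R / ρ := by
  rw [div_le_div_iff₀ (lin_pos hρ hα hv) hρ]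
  have h1 := mul_one_add_sum_le_lin hα hv
  have h2 := lin_le_mul_one_add_sum hβ hv
  have hR := upper_pos hρ hα
  nlinarith

/-- A constant for the Lipschitz bounds of the quasi-likelihood. -/
def lipConst (ρ R : ℝ) : ℝ := 1 / ρ + 1 / ρ ^ 2 + R / ρ + R ^ 2 / ρ ^ 2

lemma lipConst_pos (hρ : 0 < ρ) (hR : 0 < R) : 0 < lipConst ρ R := by
  unfold lipConst; positivity

/-- The quasi-likelihood is Lipschitz along exact ARCH values. -/
lemma abs_qlik_sub_qlik_le (hρ : 0 < ρ) (hα : ∀ j, α j ∈ Icc ρ R) (hβ : ∀ j, β j ∈ Icc ρ R)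
    (hv : ∀ j, 0 ≤ v j) (hv' : ∀ j, 0 ≤ v' j) (y : ℝ) {z : ℝ} (hz : 0 ≤ z) :
    |qlik α y v - qlik α (lin β v' * z) v'| ≤
      lipConst ρ R * (|y - lin β v' * z| + (1 + z) * ∑ j, |v j - v' j|) := by
  have hR := upper_pos hρ hα
  set w := lin α v with hw
  set w' := lin α v' with hw'
  set S := ∑ j, |v j - v' j| with hS
  have hS0 : 0 ≤ S := Finset.sum_nonneg fun j _ => abs_nonneg _
  have hwρ : ρ ≤ w := le_lin hρ hα hv
  have hw'ρ : ρ ≤ w' := le_lin hρ hα hv'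
  have hw0 := hρ.trans_le hwρ
  have hw'0 := hρ.trans_le hw'ρ
  have hd : |w - w'| ≤ R * S := abs_lin_sub_lin_le hρ hα v v'
  have h1 : |Real.log w - Real.log w'| ≤ R / ρ * S :=
    (abs_log_sub_log_le_div hρ hwρ hw'ρ).trans (by
      rw [div_mul_eq_mul_div]; exact div_le_div_of_nonneg_right hd hρ.le)
  have hq : lin β v' / w' ≤ R / ρ := lin_div_lin_le hρ hα hβ hv'
  have hq0 : 0 ≤ lin β v' / w' := div_nonneg (lin_pos hρ hβ hv').le hw'0.le
  -- Comparing with an exact value `lin β v' * z` leaves a bounded ratio `lin β v' / w'` in front of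
  -- `z`. The error in `v` is thus multiplied by `z` only and never by another past value, so no
  -- fourth moments are needed.
  have h2 : y / w - lin β v' * z / w' =
      (y - lin β v' * z) / w + lin β v' / w' * z * ((w' - w) / w) := by
    field_simp
    ring
  have h3 : |(y - lin β v' * z) / w| ≤ 1 / ρ * |y - lin β v' * z| := by
    rw [abs_div, abs_of_pos hw0, div_mul_eq_mul_div, one_mul]
    exact div_le_div_of_nonneg_left (abs_nonneg _) hρ hwρ
  have h4 : |(w' - w) / w| ≤ R / ρ * S := by
    rw [abs_div, abs_of_pos hw0, abs_sub_comm, div_mul_eq_mul_div]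
    exact div_le_div₀ (by positivity) hd hρ hwρ
  have h5 : |lin β v' / w' * z * ((w' - w) / w)| ≤ R ^ 2 / ρ ^ 2 * z * S := by
    rw [abs_mul, abs_of_nonneg (mul_nonneg hq0 hz)]
    calc lin β v' / w' * z * |(w' - w) / w| ≤ R / ρ * z * (R / ρ * S) := by gcongr
      _ = _ := by ring
  have h6 : |qlik α y v - qlik α (lin β v' * z) v'| ≤
      1 / 2 * (R / ρ * S + (1 / ρ * |y - lin β v' * z| + R ^ 2 / ρ ^ 2 * z * S)) := by
    have : qlik α y v - qlik α (lin β v' * z) v' =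
        1 / 2 * ((Real.log w - Real.log w') + (y / w - lin β v' * z / w')) := by
      simp only [qlik]; ring
    rw [this, h2, abs_mul, abs_of_nonneg (by norm_num : (0 : ℝ) ≤ 1 / 2)]
    gcongr
    refine (abs_add_le _ _).trans (add_le_add h1 ((abs_add_le _ _).trans (add_le_add h3 h5)))
  refine h6.trans ?_
  have e1 : 0 ≤ 1 / ρ := by positivity
  have e2 : 0 ≤ 1 / ρ ^ 2 := by positivity
  have e3 : 0 ≤ R / ρ := by positivity
  have e4 : 0 ≤ R ^ 2 / ρ ^ 2 := by positivity
  have e5 := abs_nonneg (y - lin β v' * z)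
  unfold lipConst
  generalize 1 / ρ = c1 at *
  generalize 1 / ρ ^ 2 = c2 at *
  generalize R / ρ = c3 at *
  generalize R ^ 2 / ρ ^ 2 = c4 at *
  generalize |y - lin β v' * z| = d at *
  have f1 := mul_nonneg e1 e5
  have f2 := mul_nonneg e2 e5
  have f3 := mul_nonneg e3 e5
  have f4 := mul_nonneg e4 e5
  have g1 := mul_nonneg e1 hS0
  have g2 := mul_nonneg e2 hS0
  have g3 := mul_nonneg e3 hS0
  have g4 := mul_nonneg e4 hS0
  have k1 := mul_nonneg g1 hz
  have k2 := mul_nonneg g2 hz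
  have k3 := mul_nonneg g3 hz
  have k4 := mul_nonneg g4 hz
  linarith

/-- The quasi-likelihood is Lipschitz in the parameter. -/
lemma abs_qlik_sub_qlik_param_le (hρ : 0 < ρ) (hα : ∀ j, α j ∈ Icc ρ R)
    (hβ : ∀ j, β j ∈ Icc ρ R) (hv : ∀ j, 0 ≤ v j) {y : ℝ} (hy : 0 ≤ y) {δ : ℝ}
    (h : ∀ j, |α j - β j| ≤ δ) :
    |qlik α y v - qlik β y v| ≤ lipConst ρ R * δ * (1 + y) := by
  have hR := upper_pos hρ hα
  have hδ : 0 ≤ δ := (abs_nonneg _).trans (h 0)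
  have hd : |lin α v - lin β v| ≤ δ * (1 + ∑ j, v j) := abs_lin_sub_lin_param_le h hv
  have hv1 : 0 ≤ ∑ j, v j := Finset.sum_nonneg fun j _ => hv j
  -- The perturbation grows with `v`, but no faster than `lin γ v`, so as a relative error it is at
  -- most δ/ρ and `v` disappears from the final bound.
  have hc : ∀ γ : Fin (p + 1) → ℝ, (∀ j, γ j ∈ Icc ρ R) →
      |lin α v - lin β v| ≤ 1 / ρ * δ * lin γ v := fun γ hγ => by
    refine hd.trans ?_
    have := mul_one_add_sum_le_lin hγ hv
    calc δ * (1 + ∑ j, v j) = 1 / ρ * δ * (ρ * (1 + ∑ j, v j)) := by field_simp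
      _ ≤ _ := by gcongr
  have h1 := abs_log_sub_log_le (lin_pos hρ hα hv) (lin_pos hρ hβ hv) (hc α hα) (hc β hβ)
  set w := lin α v with hw
  set w' := lin β v with hw'
  have hwρ : ρ ≤ w := le_lin hρ hα hv
  have hw0 := hρ.trans_le hwρ
  have hw'0 : 0 < w' := lin_pos hρ hβ hv
  have h2 : |y / w - y / w'| ≤ 1 / ρ ^ 2 * δ * y := by
    have e : y / w - y / w' = y / w * ((w' - w) / w') := by field_simp
    rw [e, abs_mul, abs_div, abs_of_nonneg hy, abs_of_pos hw0, abs_div, abs_of_pos hw'0,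
      abs_sub_comm]
    have a1 : y / w ≤ y / ρ := div_le_div_of_nonneg_left hy hρ hwρ
    have a2 : |w - w'| / w' ≤ 1 / ρ * δ := by
      rw [div_le_iff₀ hw'0]; exact hc β hβ
    calc y / w * (|w - w'| / w') ≤ y / ρ * (1 / ρ * δ) := by gcongr
      _ = _ := by field_simp
  have h3 : qlik α y v - qlik β y v =
      1 / 2 * ((Real.log w - Real.log w') + (y / w - y / w')) := by
    simp only [qlik]; ring
  rw [h3, abs_mul, abs_of_nonneg (by norm_num : (0 : ℝ) ≤ 1 / 2)]
  have h4 := (abs_add_le (Real.log w - Real.log w') (y / w - y / w')).trans (add_le_add h1 h2)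
  have e1 : 0 ≤ 1 / ρ * δ := by positivity
  have e2 : 0 ≤ 1 / ρ ^ 2 * δ := by positivity
  have e3 : 0 ≤ R / ρ * δ := by positivity
  have e4 : 0 ≤ R ^ 2 / ρ ^ 2 * δ := by positivity
  have f1 := mul_nonneg e1 hy
  have f2 := mul_nonneg e2 hy
  have f3 := mul_nonneg e3 hy
  have f4 := mul_nonneg e4 hy
  unfold lipConst
  linarith

lemma qlik_zero_lin (hρ : 0 < ρ) (hβ : ∀ j, β j ∈ Icc ρ R) (hv : ∀ j, 0 ≤ v j) :
    qlik β (lin β v) v = 1 / 2 * (Real.log (lin β v) + 1) := by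
  rw [qlik, div_self (ne_of_gt (lin_pos hρ hβ hv))]

/-- At the true conditional variance the expected quasi-likelihood is minimal. -/
lemma qlik_lin_le (hρ : 0 < ρ) (hα : ∀ j, α j ∈ Icc ρ R) (hβ : ∀ j, β j ∈ Icc ρ R)
    (hv : ∀ j, 0 ≤ v j) : qlik β (lin β v) v ≤ qlik α (lin β v) v := by
  have h1 := lin_pos hρ hα hv
  have h2 := lin_pos hρ hβ hv
  have := Real.log_le_sub_one_of_pos (div_pos h2 h1)
  rw [Real.log_div h2.ne' h1.ne'] at this
  rw [qlik_zero_lin hρ hβ hv, qlik]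
  linarith

lemma lin_eq_of_qlik_eq (hρ : 0 < ρ) (hα : ∀ j, α j ∈ Icc ρ R) (hβ : ∀ j, β j ∈ Icc ρ R)
    (hv : ∀ j, 0 ≤ v j) (h : qlik α (lin β v) v = qlik β (lin β v) v) : lin α v = lin β v := by
  have h1 := lin_pos hρ hα hv
  have h2 := lin_pos hρ hβ hv
  by_contra hne
  have := Real.log_lt_sub_one_of_pos (div_pos h2 h1) fun h' =>
    hne ((div_eq_one_iff_eq h1.ne').1 h').symm
  rw [Real.log_div h2.ne' h1.ne'] at this
  rw [qlik_zero_lin hρ hβ hv, qlik] at h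
  linarith

/-- Linear growth, from the Lipschitz bound against `v' = 0`, `z = 0`; it makes the quasi-likelihood
integrable as soon as the squares are. -/
lemma abs_qlik_le (hρ : 0 < ρ) (hα : ∀ j, α j ∈ Icc ρ R) (hv : ∀ j, 0 ≤ v j) (y : ℝ) :
    |qlik α y v| ≤ |qlik α 0 0| + lipConst ρ R * (|y| + ∑ j, v j) := by
  have h := abs_qlik_sub_qlik_le hρ hα hα hv (v' := 0) (fun _ => le_rfl) y (z := 0) le_rfl
  simp only [mul_zero, sub_zero, add_zero, one_mul, Pi.zero_apply] at h
  rw [Finset.sum_congr rfl fun j _ => abs_of_nonneg (hv j)] at h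
  have := abs_sub_abs_le_abs_sub (qlik α y v) (qlik α 0 0)
  linarith

lemma measurable_lin (α : Fin (p + 1) → ℝ) : Measurable (lin α) := by
  unfold lin; fun_prop

lemma measurable_qlik (α : Fin (p + 1) → ℝ) :
    Measurable fun q : ℝ × (Fin p → ℝ) => qlik α q.1 q.2 := by
  unfold qlik lin; fun_prop

end Deterministic

/-! ### The parameter set and a limit criterion. -/

lemma mem_Icc_of_mem_paramSet {p : ℕ} {ρ₁ ρ₂ : ℝ} (hρ₁ : 0 < ρ₁) {α : Fin (p + 1) → ℝ}
    (h : α ∈ paramSet p ρ₁ ρ₂) (j : Fin (p + 1)) : α j ∈ Icc ρ₁ (max ρ₂ 1) := by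
  obtain ⟨h1, h2, h3, h4⟩ := h
  refine Fin.cases ⟨h2, h3.trans (le_max_left _ _)⟩ (fun i => ⟨h4 i, ?_⟩) j
  refine le_trans ?_ (h1.trans (le_max_right _ _))
  exact Finset.single_le_sum (f := fun j : Fin p => α j.succ)
    (fun j _ => hρ₁.le.trans (h4 j)) (Finset.mem_univ i)

lemma isCompact_paramSet (p : ℕ) {ρ₁ : ℝ} (ρ₂ : ℝ) (hρ₁ : 0 < ρ₁) :
    IsCompact (paramSet p ρ₁ ρ₂) := by
  have hsub : paramSet p ρ₁ ρ₂ ⊆ Icc (fun _ => ρ₁) (fun _ => max ρ₂ 1) := fun α h =>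
    ⟨fun j => (mem_Icc_of_mem_paramSet hρ₁ h j).1, fun j => (mem_Icc_of_mem_paramSet hρ₁ h j).2⟩
  refine IsCompact.of_isClosed_subset isCompact_Icc ?_ hsub
  have : paramSet p ρ₁ ρ₂ = {α | ∑ j : Fin p, α j.succ ≤ 1} ∩ ({α | ρ₁ ≤ α 0} ∩
      ({α | α 0 ≤ ρ₂} ∩ ⋂ j : Fin p, {α | ρ₁ ≤ α j.succ})) := by
    ext α
    simp [paramSet]
  rw [this]
  refine (isClosed_le (by fun_prop) (by fun_prop)).inter
    ((isClosed_le (by fun_prop) (by fun_prop)).inter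
    ((isClosed_le (by fun_prop) (by fun_prop)).inter
    (isClosed_iInter fun j => isClosed_le (by fun_prop) (by fun_prop))))

lemma quasiLik_eq_qlik {p : ℕ} (x : ℕ → ℤ → ℝ) (N : ℕ) (k : ℤ) (α : Fin (p + 1) → ℝ) :
    quasiLik x N k α = qlik α (x N k ^ 2) fun j => x N (k - ((j : ℤ) + 1)) ^ 2 := rfl

lemma condVar_eq_lin {p : ℕ} (x : ℕ → ℤ → ℝ) (N : ℕ) (k : ℤ) (α : Fin (p + 1) → ℝ) :
    condVar α x N k = lin α fun j => x N (k - ((j : ℤ) + 1)) ^ 2 := rfl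

/-- The form of every limit below: an auxiliary level (truncation, Picard depth, net) is fixed to
cost at most ε, and only then N tends to infinity. -/
lemma tendsto_zero_of_forall_le_add {f : ℕ → ℝ} (h0 : ∀ N, 0 ≤ f N)
    (h : ∀ ε : ℝ, 0 < ε → ∃ g : ℕ → ℝ, Tendsto g atTop (𝓝 0) ∧ ∀ᶠ N in atTop, f N ≤ ε + g N) :
    Tendsto f atTop (𝓝 0) := by
  rw [tendsto_order]
  refine ⟨fun a ha => Eventually.of_forall fun N => ha.trans_le (h0 N), fun a ha => ?_⟩
  obtain ⟨g, hg, hfg⟩ := h (a / 2) (by linarith)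
  filter_upwards [hfg, hg.eventually_lt_const (by linarith : (0 : ℝ) < a / 2)] with N h1 h2
  linarith

/-! ### Riemann sums of functions of bounded variation. -/

section RiemannSum

/-- For a Jordan decomposition W = f - g, the sum f + g controls the increments, and its own
increments telescope. -/
lemma exists_monotoneOn_abs_sub_le {W : ℝ → ℝ} {s : Set ℝ} (h : BoundedVariationOn W s) :
    ∃ v : ℝ → ℝ, MonotoneOn v s ∧ ∀ x ∈ s, ∀ y ∈ s, x ≤ y → |W y - W x| ≤ v y - v x := by
  obtain ⟨f, g, hf, hg, hW⟩ :=
    h.locallyBoundedVariationOn.exists_monotoneOn_sub_monotoneOn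
  refine ⟨f + g, hf.add hg, fun x hx y hy hxy => ?_⟩
  have h1 := hf hx hy hxy
  have h2 := hg hx hy hxy
  simp only [hW, Pi.sub_apply, Pi.add_apply]
  rw [abs_le]
  constructor <;> linarith

lemma exists_abs_le_of_boundedVariationOn {W : ℝ → ℝ} {s : Set ℝ} (h : BoundedVariationOn W s) :
    ∃ K : ℝ, 0 < K ∧ ∀ x ∈ s, |W x| ≤ K := by
  rcases s.eq_empty_or_nonempty with rfl | ⟨y, hy⟩
  · exact ⟨1, one_pos, fun x hx => hx.elim⟩
  · refine ⟨|W y| + (eVariationOn W s).toReal + 1, by positivity, fun x hx => ?_⟩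
    have := h.dist_le hx hy
    rw [Real.dist_eq] at this
    have := abs_sub_abs_le_abs_sub (W x) (W y)
    linarith

lemma exists_abs_riemannSum_sub_integral_le {W : ℝ → ℝ}
    (hW : BoundedVariationOn W (Icc (-1 / 2) (1 / 2)))
    (hi : IntervalIntegrable W volume (-1 / 2) (1 / 2)) :
    ∃ C : ℝ, 0 ≤ C ∧ ∀ (h : ℝ) (n : ℕ), 0 < h → n * h ≤ 1 / 2 → 1 / 2 < (n + 1) * h →
      |∑ i ∈ Finset.range (2 * n + 1), h * W (((i : ℝ) - n) * h) -
        ∫ x in (-1 / 2 : ℝ)..(1 / 2), W x| ≤ C * h := by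
  obtain ⟨v, hv, hWv⟩ := exists_monotoneOn_abs_sub_le hW
  obtain ⟨K, hK, hWK⟩ := exists_abs_le_of_boundedVariationOn hW
  have hv0 : v (-1 / 2) ≤ v (1 / 2) := hv (by norm_num) (by norm_num) (by norm_num)
  -- The variation term comes from the 2n full cells. The three K's pay for the two end pieces, each
  -- shorter than h, and for the last node, which starts no cell.
  refine ⟨v (1 / 2) - v (-1 / 2) + 3 * K, by linarith, fun h n hh hn hn' => ?_⟩
  set x : ℕ → ℝ := fun i => ((i : ℝ) - n) * h with hx
  have hxmono : ∀ i, x i ≤ x (i + 1) := fun i => by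
    simp only [hx]; push_cast; nlinarith
  have hxmem : ∀ i, i ≤ 2 * n → x i ∈ Icc (-1 / 2 : ℝ) (1 / 2) := fun i hi => by
    have h2 : (i : ℝ) ≤ 2 * n := by exact_mod_cast hi
    have h0 : (0 : ℝ) ≤ i := Nat.cast_nonneg i
    simp only [hx, mem_Icc]
    constructor <;> nlinarith
  have hintg : ∀ y ∈ Icc (-1 / 2 : ℝ) (1 / 2), ∀ z ∈ Icc (-1 / 2 : ℝ) (1 / 2),
      IntervalIntegrable W volume y z := fun y hy z hz => by
    refine hi.mono_set ?_
    rw [uIcc_of_le (by norm_num : (-1 / 2 : ℝ) ≤ 1 / 2)]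
    exact ordConnected_Icc.uIcc_subset hy hz
  have hl : (-1 / 2 : ℝ) ∈ Icc (-1 / 2 : ℝ) (1 / 2) := by norm_num
  have hr : (1 / 2 : ℝ) ∈ Icc (-1 / 2 : ℝ) (1 / 2) := by norm_num
  have hx0 := hxmem 0 (by omega)
  have hx2 := hxmem (2 * n) le_rfl
  have hsplit : ∫ y in (-1 / 2 : ℝ)..(1 / 2), W y =
      (∫ y in (-1 / 2 : ℝ)..(x 0), W y) + (∫ y in (x 0)..(x (2 * n)), W y) +
        ∫ y in (x (2 * n))..(1 / 2), W y := by
    rw [intervalIntegral.integral_add_adjacent_intervals (hintg _ hl _ hx0) (hintg _ hx0 _ hx2),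
      intervalIntegral.integral_add_adjacent_intervals (hintg _ hl _ hx2) (hintg _ hx2 _ hr)]
  have hmid : ∫ y in (x 0)..(x (2 * n)), W y =
      ∑ i ∈ Finset.range (2 * n), ∫ y in (x i)..(x (i + 1)), W y :=
    (intervalIntegral.sum_integral_adjacent_intervals fun k hk =>
      hintg _ (hxmem k hk.le) _ (hxmem (k + 1) hk)).symm
  have hstep : ∀ i ∈ Finset.range (2 * n),
      |h * W (x i) - ∫ y in (x i)..(x (i + 1)), W y| ≤ (v (x (i + 1)) - v (x i)) * h := by
    intro i hi
    rw [Finset.mem_range] at hi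
    have hlen : x (i + 1) - x i = h := by simp only [hx]; push_cast; ring
    have e : h * W (x i) - ∫ y in (x i)..(x (i + 1)), W y =
        ∫ y in (x i)..(x (i + 1)), (W (x i) - W y) := by
      rw [intervalIntegral.integral_sub intervalIntegrable_const
        (hintg _ (hxmem i hi.le) _ (hxmem (i + 1) hi)), intervalIntegral.integral_const, hlen,
        smul_eq_mul]
    rw [e, ← Real.norm_eq_abs]
    refine (intervalIntegral.norm_integral_le_of_norm_le_const
      (C := v (x (i + 1)) - v (x i)) fun y hy => ?_).trans ?_
    · rw [uIoc_of_le (hxmono i)] at hy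
      have hxi := hxmem i hi.le
      have hxi' := hxmem (i + 1) hi
      have hym : y ∈ Icc (-1 / 2 : ℝ) (1 / 2) := ⟨hxi.1.trans hy.1.le, hy.2.trans hxi'.2⟩
      rw [Real.norm_eq_abs, abs_sub_comm]
      exact (hWv _ hxi _ hym hy.1.le).trans (sub_le_sub_right (hv hym hxi' hy.2) _)
    · rw [hlen, abs_of_pos hh]
  have hsum : |∑ i ∈ Finset.range (2 * n), (h * W (x i) - ∫ y in (x i)..(x (i + 1)), W y)| ≤
      (v (1 / 2) - v (-1 / 2)) * h := by
    refine (Finset.abs_sum_le_sum_abs _ _).trans ((Finset.sum_le_sum hstep).trans ?_)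
    rw [← Finset.sum_mul, Finset.sum_range_sub (fun i => v (x i))]
    have h1 := hv hl hx0 hx0.1
    have h2 := hv hx2 hr hx2.2
    exact mul_le_mul_of_nonneg_right (by linarith) hh.le
  have hedge : ∀ y ∈ Icc (-1 / 2 : ℝ) (1 / 2), ∀ z ∈ Icc (-1 / 2 : ℝ) (1 / 2), |z - y| ≤ h →
      |∫ t in y..z, W t| ≤ K * h := fun y hy z hz hyz => by
    rw [← Real.norm_eq_abs]
    refine (intervalIntegral.norm_integral_le_of_norm_le_const (C := K) fun t ht => ?_).trans
      (mul_le_mul_of_nonneg_left hyz hK.le)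
    exact hWK t (ordConnected_Icc.uIcc_subset hy hz (uIoc_subset_uIcc ht))
  have he1 := hedge _ hl _ hx0 (by
    rw [abs_of_nonneg (by linarith [hx0.1])]; simp only [hx]; push_cast; linarith)
  have he2 := hedge _ hx2 _ hr (by
    rw [abs_of_nonneg (by linarith [hx2.2])]; simp only [hx]; push_cast; linarith)
  have he3 : |h * W (x (2 * n))| ≤ K * h := by
    rw [abs_mul, abs_of_pos hh, mul_comm]
    exact mul_le_mul_of_nonneg_right (hWK _ hx2) hh.le
  rw [Finset.sum_range_succ, hsplit, hmid]
  rw [Finset.sum_sub_distrib] at hsum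
  rw [abs_le] at *
  constructor <;> linarith [hsum.1, hsum.2, he1.1, he1.2, he2.1, he2.2, he3.1, he3.2]

end RiemannSum

/-! ### Kernel weights: support, size and total mass. -/

/-- The kernel weight of the observation at time `k`, for the bandwidth `h` on the original time
scale. -/
def kernelWeight (W : ℝ → ℝ) (h : ℝ) (t₀ k : ℕ) : ℝ :=
  1 / h * (Icc (-1 / 2 : ℝ) (1 / 2)).indicator W (((t₀ : ℝ) - k) / h)

lemma weightedLik_eq {p : ℕ} (W : ℝ → ℝ) (b : ℝ) (t₀ : ℕ) (x : ℕ → ℤ → ℝ) (N : ℕ)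
    (α : Fin (p + 1) → ℝ) :
    weightedLik W b t₀ x N α =
      ∑ k ∈ Finset.Icc (p + 1) N, kernelWeight W (b * N) t₀ k * quasiLik x N (k : ℤ) α := rfl

section KernelWeight

variable {W : ℝ → ℝ} {h : ℝ} {t₀ k : ℕ}

lemma abs_sub_le_of_kernelWeight_ne_zero (hh : 0 < h) (hk : kernelWeight W h t₀ k ≠ 0) :
    |(t₀ : ℝ) - k| ≤ h / 2 := by
  have h1 : ((t₀ : ℝ) - k) / h ∈ Icc (-1 / 2 : ℝ) (1 / 2) := by
    by_contra hc
    exact hk (by rw [kernelWeight, indicator_of_notMem hc, mul_zero])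
  rw [mem_Icc, le_div_iff₀ hh, div_le_iff₀ hh] at h1
  rw [abs_le]
  constructor <;> linarith [h1.1, h1.2]

lemma abs_kernelWeight_le {K : ℝ} (hK : ∀ x ∈ Icc (-1 / 2 : ℝ) (1 / 2), |W x| ≤ K) (hK0 : 0 ≤ K)
    (hh : 0 < h) : |kernelWeight W h t₀ k| ≤ K / h := by
  rw [kernelWeight, abs_mul, abs_of_pos (one_div_pos.2 hh), div_mul_eq_mul_div, one_mul]
  refine div_le_div_of_nonneg_right ?_ hh.le
  by_cases hm : ((t₀ : ℝ) - k) / h ∈ Icc (-1 / 2 : ℝ) (1 / 2)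
  · rw [indicator_of_mem hm]; exact hK _ hm
  · rw [indicator_of_notMem hm, abs_zero]; exact hK0

/-- At most h + 1 integers lie in a window of length h, and each weight is at most K/h; the constant
4 is generous. -/
lemma sum_abs_kernelWeight_le {K : ℝ} (hK : ∀ x ∈ Icc (-1 / 2 : ℝ) (1 / 2), |W x| ≤ K)
    (hK0 : 0 ≤ K) (hh : 1 ≤ h) (s : Finset ℕ) :
    ∑ k ∈ s, |kernelWeight W h t₀ k| ≤ 4 * K := by
  have h0 : 0 < h := by linarith
  set n : ℕ := ⌈h⌉₊ with hn
  have hsub : s.filter (fun k => kernelWeight W h t₀ k ≠ 0) ⊆ Finset.Icc (t₀ - n) (t₀ + n) := by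
    intro k hk
    have hk := abs_sub_le_of_kernelWeight_ne_zero h0 (Finset.mem_filter.1 hk).2
    rw [abs_le] at hk
    have hle := Nat.le_ceil h
    rw [← hn] at hle
    rw [Finset.mem_Icc, Nat.sub_le_iff_le_add]
    constructor
    · have : (t₀ : ℝ) ≤ k + n := by linarith [hk.2]
      exact_mod_cast this
    · have : (k : ℝ) ≤ t₀ + n := by linarith [hk.1]
      exact_mod_cast this
  have hcard : ((s.filter (fun k => kernelWeight W h t₀ k ≠ 0)).card : ℝ) ≤ h + 1 := by
    set u := s.filter (fun k => kernelWeight W h t₀ k ≠ 0) with hu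
    rcases u.eq_empty_or_nonempty with he | hne
    · rw [he]; simp; linarith
    have hmM : u ⊆ Finset.Icc (u.min' hne) (u.max' hne) := fun k hk =>
      Finset.mem_Icc.2 ⟨u.min'_le k hk, u.le_max' k hk⟩
    have hc := Finset.card_le_card hmM
    rw [Nat.card_Icc] at hc
    have h1 := abs_sub_le_of_kernelWeight_ne_zero h0 (Finset.mem_filter.1 (u.min'_mem hne)).2
    have h2 := abs_sub_le_of_kernelWeight_ne_zero h0 (Finset.mem_filter.1 (u.max'_mem hne)).2
    have h3 := u.min'_le _ (u.max'_mem hne)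
    have h4 : (u.card : ℝ) ≤ u.max' hne + 1 - u.min' hne := by
      have : u.card + u.min' hne ≤ u.max' hne + 1 := by omega
      have : ((u.card + u.min' hne : ℕ) : ℝ) ≤ (u.max' hne + 1 : ℕ) := by exact_mod_cast this
      push_cast at this
      linarith
    rw [abs_le] at h1 h2
    linarith [h1.2, h2.1]
  have hfil : ∑ k ∈ s, |kernelWeight W h t₀ k| =
      ∑ k ∈ s.filter (fun k => kernelWeight W h t₀ k ≠ 0), |kernelWeight W h t₀ k| := by
    rw [Finset.sum_filter]
    refine Finset.sum_congr rfl fun k _ => ?_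
    split_ifs with hc
    · rfl
    · rw [not_not.1 hc, abs_zero]
  rw [hfil]
  refine (Finset.sum_le_card_nsmul _ _ (K / h) fun k _ => abs_kernelWeight_le hK hK0 h0).trans ?_
  rw [nsmul_eq_mul, mul_div_assoc', div_le_iff₀ h0]
  nlinarith

lemma sum_kernelWeight_eq (hh : 0 < h) {n a N : ℕ} (hn : (n : ℝ) ≤ h / 2) (hn' : h / 2 < n + 1)
    (ha : a + n ≤ t₀) (hN : t₀ + n ≤ N) :
    ∑ k ∈ Finset.Icc a N, kernelWeight W h t₀ k =
      ∑ i ∈ Finset.range (2 * n + 1), 1 / h * W (((i : ℝ) - n) * (1 / h)) := by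
  have h1 : ∑ k ∈ Finset.Icc (t₀ - n) (t₀ + n), kernelWeight W h t₀ k =
      ∑ k ∈ Finset.Icc a N, kernelWeight W h t₀ k := by
    refine Finset.sum_subset (Finset.Icc_subset_Icc (by omega) hN) fun k _ hk => ?_
    by_contra hne
    have hk' := abs_sub_le_of_kernelWeight_ne_zero hh hne
    rw [abs_le] at hk'
    refine hk (Finset.mem_Icc.2 ⟨?_, ?_⟩)
    · have : (t₀ : ℝ) < k + n + 1 := by linarith [hk'.2]
      have : t₀ < k + n + 1 := by exact_mod_cast this
      omega
    · have : (k : ℝ) < t₀ + n + 1 := by linarith [hk'.1]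
      have : k < t₀ + n + 1 := by exact_mod_cast this
      omega
  rw [← h1]
  -- The reflection makes `i - n` equal to `t₀ - k`, the argument of the kernel.
  refine Finset.sum_nbij' (fun k => t₀ + n - k) (fun i => t₀ + n - i) ?_ ?_ ?_ ?_ ?_
  · intro k hk; rw [Finset.mem_Icc] at hk; rw [Finset.mem_range]; omega
  · intro i hi; rw [Finset.mem_range] at hi; rw [Finset.mem_Icc]; omega
  · intro k hk; rw [Finset.mem_Icc] at hk; omega
  · intro i hi; rw [Finset.mem_range] at hi; omega
  · intro k hk
    rw [Finset.mem_Icc] at hk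
    have hc : ((t₀ + n - k : ℕ) : ℝ) = t₀ + n - k := by
      rw [Nat.cast_sub hk.2]; push_cast; ring
    have hk1 : (t₀ : ℝ) ≤ k + n := by
      have : t₀ ≤ k + n := by omega
      exact_mod_cast this
    have hk2 : (k : ℝ) ≤ t₀ + n := by exact_mod_cast hk.2
    rw [kernelWeight, indicator_of_mem, hc]
    · congr 2; ring
    · rw [mem_Icc, le_div_iff₀ hh, div_le_iff₀ hh]
      constructor <;> linarith

/-- The kernel weights sum to one asymptotically. -/
lemma tendsto_sum_kernelWeight (hW : IsKernel W) (a : ℕ) {t₀ : ℕ → ℕ} {h : ℕ → ℝ}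
    (hh : Tendsto h atTop atTop) (hl : ∀ᶠ N : ℕ in atTop, (a : ℝ) + h N / 2 ≤ t₀ N)
    (hr : ∀ᶠ N : ℕ in atTop, (t₀ N : ℝ) + h N / 2 ≤ N) :
    Tendsto (fun N => ∑ k ∈ Finset.Icc a N, kernelWeight W (h N) (t₀ N) k) atTop (𝓝 1) := by
  -- A non-integrable function has integral 0 by convention, so total mass 1 forces integrability.
  have hi : IntervalIntegrable W volume (-1 / 2) (1 / 2) := by
    by_contra hc
    have := hW.integral_eq_one
    rw [intervalIntegral.integral_undef hc] at this
    exact zero_ne_one this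
  obtain ⟨C, -, hC⟩ := exists_abs_riemannSum_sub_integral_le hW.boundedVariation hi
  rw [hW.integral_eq_one] at hC
  rw [tendsto_iff_dist_tendsto_zero]
  refine squeeze_zero' (g := fun N => C * (1 / h N)) (Eventually.of_forall fun N => dist_nonneg)
    ?_ ?_
  · filter_upwards [hl, hr, hh.eventually_gt_atTop 0] with N h1 h2 h0
    have hfl := Nat.floor_le (by linarith : 0 ≤ h N / 2)
    have hfl' := Nat.lt_floor_add_one (h N / 2)
    rw [sum_kernelWeight_eq h0 hfl hfl', Real.dist_eq]
    · refine hC (1 / h N) _ (one_div_pos.2 h0) ?_ ?_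
      · rw [mul_one_div, div_le_iff₀ h0]; linarith
      · rw [mul_one_div, lt_div_iff₀ h0]; linarith
    · have : (a : ℝ) + (⌊h N / 2⌋₊ : ℕ) ≤ t₀ N := by linarith
      exact_mod_cast this
    · have : (t₀ N : ℝ) + (⌊h N / 2⌋₊ : ℕ) ≤ N := by linarith
      exact_mod_cast this
  · simpa using (tendsto_inv_atTop_zero.comp hh).const_mul C

end KernelWeight

/-! ### A weighted law of large numbers under finite-range dependence. -/

section LawOfLargeNumbers

variable {S : Type*} [MeasurableSpace S] {P : Measure S}

lemma integral_le_add_add_const [IsProbabilityMeasure P] {f g h : S → ℝ} (hf : Integrable f P)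
    (hg : Integrable g P) (hh : Integrable h P) {c : ℝ}
    (hle : ∀ᵐ ω ∂P, f ω ≤ g ω + h ω + c) :
    ∫ ω, f ω ∂P ≤ ∫ ω, g ω ∂P + ∫ ω, h ω ∂P + c := by
  have h1 := integral_mono_ae hf ((hg.add hh).add (integrable_const c)) hle
  have h2 : ∫ ω, (g + h + fun _ => c : S → ℝ) ω ∂P = ∫ ω, g ω ∂P + ∫ ω, h ω ∂P + c := by
    rw [integral_add' (hg.add hh) (integrable_const c), integral_add' hg hh, integral_const,
      probReal_univ, one_smul]
  exact h1.trans_eq h2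

lemma integral_abs_le_sqrt_integral_sq [IsProbabilityMeasure P] {f : S → ℝ} (hf : MemLp f 2 P) :
    ∫ ω, |f ω| ∂P ≤ Real.sqrt (∫ ω, f ω ^ 2 ∂P) := by
  refine Real.le_sqrt_of_sq_le ?_
  have h := variance_nonneg (fun ω => |f ω|) P
  rw [variance_eq_sub (by simpa using hf.norm)] at h
  simp only [Pi.pow_apply, sq_abs] at h
  linarith

/-- Weak law of large numbers with weights for bounded, finite-range dependent sequences. -/
lemma integral_abs_weighted_sum_sub_le [IsProbabilityMeasure P] {ξ : ℕ → S → ℝ} {M : ℝ} (hM : 0 ≤ M)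
    (hm : ∀ k, Measurable (ξ k)) (hb : ∀ k ω, |ξ k ω| ≤ M) (q : ℕ)
    (hind : ∀ k l, k + q < l → IndepFun (ξ k) (ξ l) P) (s : Finset ℕ) (c : ℕ → ℝ) {C e : ℝ}
    (hC : ∑ k ∈ s, |c k| ≤ C) (he : ∀ k ∈ s, |c k| ≤ e) (he0 : 0 ≤ e) :
    ∫ ω, |∑ k ∈ s, c k * ξ k ω - ∑ k ∈ s, c k * ∫ ω, ξ k ω ∂P| ∂P ≤
      Real.sqrt (C * ((2 * q + 1) * e) * (2 * M) ^ 2) := by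
  have hL : ∀ k, MemLp (ξ k) 2 P := fun k =>
    MemLp.of_bound (hm k).aestronglyMeasurable M (Eventually.of_forall fun ω => hb k ω)
  have hLc : ∀ k ∈ s, MemLp (fun ω => c k * ξ k ω) 2 P := fun k _ => (hL k).const_mul (c k)
  have hsum : MemLp (fun ω => ∑ k ∈ s, c k * ξ k ω) 2 P := memLp_finsetSum s hLc
  have hmean : ∫ ω, ∑ k ∈ s, c k * ξ k ω ∂P = ∑ k ∈ s, c k * ∫ ω, ξ k ω ∂P := by
    rw [integral_finsetSum s fun k hk => (hLc k hk).integrable (by norm_num)]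
    simp only [integral_const_mul]
  have hvar : Var[fun ω => ∑ k ∈ s, c k * ξ k ω; P] =
      ∫ ω, (∑ k ∈ s, c k * ξ k ω - ∑ k ∈ s, c k * ∫ ω, ξ k ω ∂P) ^ 2 ∂P := by
    rw [variance_eq_integral hsum.aestronglyMeasurable.aemeasurable, hmean]
  have hi : ∀ k, |∫ ω, ξ k ω ∂P| ≤ M := fun k => by
    have := norm_integral_le_of_norm_le_const (μ := P) (f := ξ k) (C := M)
      (Eventually.of_forall fun ω => hb k ω)
    simpa using this
  have hcov : ∀ k l, |cov[ξ k, ξ l; P]| ≤ (2 * M) ^ 2 := fun k l => by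
    have := norm_integral_le_of_norm_le_const (μ := P)
      (f := fun ω => (ξ k ω - ∫ ω, ξ k ω ∂P) * (ξ l ω - ∫ ω, ξ l ω ∂P)) (C := (2 * M) ^ 2)
      (Eventually.of_forall fun ω => by
        rw [norm_mul, sq]
        have h : ∀ k, ‖ξ k ω - ∫ ω, ξ k ω ∂P‖ ≤ 2 * M := fun k =>
          (abs_sub _ _).trans (by linarith [hb k ω, hi k])
        exact mul_le_mul (h k) (h l) (norm_nonneg _) (by linarith))
    simpa [covariance] using this
  -- In the double sum of covariances each `k` meets at most 2q + 1 indices `l` with a nonzero term;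
  -- one weight is bounded by `e`, the other is summed to `C`.
  have hbound : Var[fun ω => ∑ k ∈ s, c k * ξ k ω; P] ≤ C * ((2 * q + 1) * e) * (2 * M) ^ 2 := by
    rw [variance_fun_sum' hLc]
    have hterm : ∀ k ∈ s, ∑ l ∈ s, cov[fun ω => c k * ξ k ω, fun ω => c l * ξ l ω; P] ≤
        |c k| * ((2 * q + 1) * e * (2 * M) ^ 2) := by
      intro k _
      have hz : ∀ l ∈ s, cov[fun ω => c k * ξ k ω, fun ω => c l * ξ l ω; P] ≤
          if l ∈ Finset.Icc (k - q) (k + q) then |c k| * (e * (2 * M) ^ 2) else 0 := by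
        intro l hl
        rw [covariance_const_mul_left, covariance_const_mul_right]
        split_ifs with hkl
        · refine (le_abs_self _).trans ?_
          rw [abs_mul, abs_mul]
          have := hcov k l
          have := he l hl
          gcongr
        · have : cov[ξ k, ξ l; P] = 0 := by
            rw [Finset.mem_Icc] at hkl
            rcases Nat.lt_or_ge (k + q) l with h | h
            · exact (hind k l h).covariance_eq_zero (hL k) (hL l)
            · exact (hind l k (by omega)).symm.covariance_eq_zero (hL k) (hL l)
          rw [this, mul_zero, mul_zero]
      refine (Finset.sum_le_sum hz).trans ?_
      rw [← Finset.sum_filter, Finset.sum_const, nsmul_eq_mul]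
      have hcard : ((s.filter fun l => l ∈ Finset.Icc (k - q) (k + q)).card : ℝ) ≤ 2 * q + 1 := by
        have h1 : s.filter (fun l => l ∈ Finset.Icc (k - q) (k + q)) ⊆
            Finset.Icc (k - q) (k + q) := fun l hl => (Finset.mem_filter.1 hl).2
        have h2 := Finset.card_le_card h1
        rw [Nat.card_Icc] at h2
        have h3 : (s.filter fun l => l ∈ Finset.Icc (k - q) (k + q)).card ≤ 2 * q + 1 := by omega
        exact_mod_cast h3
      calc _ ≤ (2 * (q : ℝ) + 1) * (|c k| * (e * (2 * M) ^ 2)) := by gcongr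
        _ = _ := by ring
    refine (Finset.sum_le_sum hterm).trans ?_
    rw [← Finset.sum_mul]
    calc (∑ k ∈ s, |c k|) * ((2 * q + 1) * e * (2 * M) ^ 2) ≤
        C * ((2 * q + 1) * e * (2 * M) ^ 2) := by gcongr
      _ = _ := by ring
  refine (integral_abs_le_sqrt_integral_sq ?_).trans (Real.sqrt_le_sqrt ?_)
  · exact hsum.sub (memLp_const _)
  · rw [← hvar]; exact hbound

/-- Truncation at level `M`. -/
def trunc (M x : ℝ) : ℝ := max (-M) (min x M)

lemma measurable_trunc (M : ℝ) : Measurable (trunc M) := by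
  unfold trunc; fun_prop

lemma abs_trunc_le {M : ℝ} (hM : 0 ≤ M) (x : ℝ) : |trunc M x| ≤ M := by
  rw [abs_le, trunc]
  exact ⟨le_max_left _ _, max_le (by linarith) (min_le_right _ _)⟩

lemma trunc_eq_self {M x : ℝ} (h : |x| ≤ M) : trunc M x = x := by
  rw [abs_le] at h
  rw [trunc, min_eq_left h.2, max_eq_right h.1]

lemma abs_sub_trunc_le {M : ℝ} (hM : 0 ≤ M) (x : ℝ) : |x - trunc M x| ≤ |x| := by
  rcases le_total |x| M with h | h
  · rw [trunc_eq_self h, sub_self, abs_zero]; exact abs_nonneg _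
  · rcases le_total 0 x with hx | hx
    · rw [abs_of_nonneg hx] at h
      rw [trunc, min_eq_right h, max_eq_right (by linarith), abs_of_nonneg (by linarith),
        abs_of_nonneg hx]
      linarith
    · rw [abs_of_nonpos hx] at h
      rw [trunc, min_eq_left (by linarith), max_eq_left (by linarith),
        abs_of_nonpos (by linarith), abs_of_nonpos hx]
      linarith

lemma tendsto_integral_abs_sub_trunc {f : S → ℝ} (hf : Integrable f P) :
    Tendsto (fun M : ℕ => ∫ ω, |f ω - trunc M (f ω)| ∂P) atTop (𝓝 0) := by
  rw [← integral_zero S ℝ (μ := P)]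
  refine tendsto_integral_of_dominated_convergence (fun ω => |f ω|) (fun M => ?_) hf.abs
    (fun M => Eventually.of_forall fun ω => ?_) (Eventually.of_forall fun ω => ?_)
  · exact (hf.aestronglyMeasurable.sub ((measurable_trunc M).comp_aemeasurable
      hf.aestronglyMeasurable.aemeasurable).aestronglyMeasurable).norm
  · rw [Real.norm_eq_abs, abs_abs]
    exact abs_sub_trunc_le (Nat.cast_nonneg M) _
  · refine tendsto_const_nhds.congr' ?_
    obtain ⟨n, hn⟩ := exists_nat_ge |f ω|
    filter_upwards [eventually_ge_atTop n] with M hM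
    rw [trunc_eq_self (hn.trans (by exact_mod_cast hM)), sub_self, abs_zero]

lemma integral_abs_sum_le {ι : Type*} (s : Finset ι) (c : ι → ℝ) {f : ι → S → ℝ}
    (hf : ∀ k ∈ s, Integrable (f k) P) :
    ∫ ω, |∑ k ∈ s, c k * f k ω| ∂P ≤ ∑ k ∈ s, |c k| * ∫ ω, |f k ω| ∂P := by
  have h1 : ∀ k ∈ s, Integrable (fun ω => |c k| * |f k ω|) P := fun k hk =>
    (hf k hk).abs.const_mul _
  have h2 : ∑ k ∈ s, |c k| * ∫ ω, |f k ω| ∂P = ∫ ω, ∑ k ∈ s, |c k| * |f k ω| ∂P := by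
    rw [integral_finsetSum s h1]
    simp only [integral_const_mul]
  rw [h2]
  refine integral_mono (integrable_finsetSum s fun k hk => (hf k hk).const_mul (c k)).abs
    (integrable_finsetSum s h1) fun ω => ?_
  refine (Finset.abs_sum_le_sum_abs _ _).trans_eq (Finset.sum_congr rfl fun k _ => abs_mul _ _)

/-- Weighted weak law of large numbers in `L¹` for identically distributed sequences with
finite-range dependence. -/
lemma tendsto_integral_abs_weighted_sum_sub [IsProbabilityMeasure P] {ξ : ℕ → S → ℝ}
    (hm : ∀ k, Measurable (ξ k)) (hid : ∀ k, IdentDistrib (ξ k) (ξ 0) P P)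
    (hintg : Integrable (ξ 0) P) (q : ℕ) (hind : ∀ k l, k + q < l → IndepFun (ξ k) (ξ l) P)
    (s : ℕ → Finset ℕ) (c : ℕ → ℕ → ℝ) {C : ℝ} {e : ℕ → ℝ}
    (hC : ∀ᶠ N in atTop, ∑ k ∈ s N, |c N k| ≤ C)
    (he : ∀ᶠ N in atTop, 0 ≤ e N ∧ ∀ k ∈ s N, |c N k| ≤ e N) (he0 : Tendsto e atTop (𝓝 0))
    (h1 : Tendsto (fun N => ∑ k ∈ s N, c N k) atTop (𝓝 1)) :
    Tendsto (fun N => ∫ ω, |∑ k ∈ s N, c N k * ξ k ω - ∫ ω, ξ 0 ω ∂P| ∂P) atTop (𝓝 0) := by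
  refine tendsto_zero_of_forall_le_add (fun N => integral_nonneg fun ω => abs_nonneg _)
    fun ε hε => ?_
  have hintk : ∀ k, Integrable (ξ k) P := fun k => (hid k).integrable_iff.2 hintg
  -- Only a first moment is available, hence truncation. The truncation error enters `C` times
  -- through the weighted sum and once more through the mean.
  have htail : Tendsto (fun M : ℕ => (C + 1) * ∫ ω, |ξ 0 ω - trunc M (ξ 0 ω)| ∂P) atTop (𝓝 0) := by
    simpa using (tendsto_integral_abs_sub_trunc hintg).const_mul (C + 1)
  obtain ⟨M, hM⟩ := (htail.eventually_lt_const hε).exists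
  set η : ℕ → S → ℝ := fun k ω => trunc M (ξ k ω) with hη
  have hηm : ∀ k, Measurable (η k) := fun k => (measurable_trunc M).comp (hm k)
  have hηb : ∀ k ω, |η k ω| ≤ M := fun k ω => abs_trunc_le (Nat.cast_nonneg M) _
  have hηi : ∀ k, Integrable (η k) P := fun k =>
    Integrable.of_bound (hηm k).aestronglyMeasurable M (Eventually.of_forall fun ω => hηb k ω)
  have hηmean : ∀ k, ∫ ω, η k ω ∂P = ∫ ω, η 0 ω ∂P := fun k =>
    ((hid k).comp (measurable_trunc M)).integral_eq
  have hηind : ∀ k l, k + q < l → IndepFun (η k) (η l) P := fun k l h =>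
    (hind k l h).comp (measurable_trunc M) (measurable_trunc M)
  set T := ∫ ω, |ξ 0 ω - η 0 ω| ∂P with hT
  have hTk : ∀ k, ∫ ω, |ξ k ω - η k ω| ∂P = T := fun k => by
    have hf : Measurable fun x => |x - trunc M x| :=
      (measurable_id.sub (measurable_trunc M)).abs
    exact ((hid k).comp hf).integral_eq
  have hm0 : |∫ ω, η 0 ω ∂P - ∫ ω, ξ 0 ω ∂P| ≤ T := by
    rw [← integral_sub (hηi 0) hintg]
    refine (abs_integral_le_integral_abs).trans_eq ?_
    simp only [abs_sub_comm]
    rfl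
  refine ⟨fun N => Real.sqrt (C * ((2 * q + 1) * e N) * (2 * M) ^ 2) +
    |∑ k ∈ s N, c N k - 1| * |∫ ω, η 0 ω ∂P|, ?_, ?_⟩
  · have t1 : Tendsto (fun N => Real.sqrt (C * ((2 * q + 1) * e N) * (2 * M) ^ 2)) atTop
        (𝓝 0) := by
      have : Tendsto (fun N => C * ((2 * q + 1) * e N) * (2 * (M : ℝ)) ^ 2) atTop (𝓝 0) := by
        simpa using ((he0.const_mul (2 * (q : ℝ) + 1)).const_mul C).mul_const ((2 * (M : ℝ)) ^ 2)
      simpa using this.sqrt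
    have t2 : Tendsto (fun N => |∑ k ∈ s N, c N k - 1| * |∫ ω, η 0 ω ∂P|) atTop (𝓝 0) := by
      simpa using (h1.sub_const 1).abs.mul_const |∫ ω, η 0 ω ∂P|
    simpa using t1.add t2
  · filter_upwards [hC, he] with N hCN heN
    have hT0 : 0 ≤ T := integral_nonneg fun ω => abs_nonneg _
    have b1 := integral_abs_sum_le (P := P) (s N) (c N) (f := fun k ω => ξ k ω - η k ω)
      fun k _ => (hintk k).sub (hηi k)
    simp only [hTk, ← Finset.sum_mul] at b1
    have b1' := b1.trans (mul_le_mul_of_nonneg_right hCN hT0)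
    have b2 := integral_abs_weighted_sum_sub_le (Nat.cast_nonneg M) hηm hηb q hηind (s N) (c N)
      hCN heN.2 heN.1
    simp only [hηmean, ← Finset.sum_mul] at b2
    have i1 : Integrable (fun ω => ∑ k ∈ s N, c N k * (ξ k ω - η k ω)) P :=
      integrable_finsetSum _ fun k _ => ((hintk k).sub (hηi k)).const_mul _
    have i2 : Integrable (fun ω => ∑ k ∈ s N, c N k * η k ω -
        (∑ k ∈ s N, c N k) * ∫ ω, η 0 ω ∂P) P :=
      (integrable_finsetSum _ fun k _ => (hηi k).const_mul _).sub (integrable_const _)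
    have i3 : Integrable (fun ω => ∑ k ∈ s N, c N k * ξ k ω - ∫ ω, ξ 0 ω ∂P) P :=
      (integrable_finsetSum _ fun k _ => (hintk k).const_mul _).sub (integrable_const _)
    have hpt : ∀ ω, |∑ k ∈ s N, c N k * ξ k ω - ∫ ω, ξ 0 ω ∂P| ≤
        (|∑ k ∈ s N, c N k * (ξ k ω - η k ω)| + |∑ k ∈ s N, c N k * η k ω -
          (∑ k ∈ s N, c N k) * ∫ ω, η 0 ω ∂P|) +
        (|∑ k ∈ s N, c N k - 1| * |∫ ω, η 0 ω ∂P| + T) := fun ω => by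
      have e1 : ∑ k ∈ s N, c N k * ξ k ω - ∫ ω, ξ 0 ω ∂P =
          (∑ k ∈ s N, c N k * (ξ k ω - η k ω) + (∑ k ∈ s N, c N k * η k ω -
            (∑ k ∈ s N, c N k) * ∫ ω, η 0 ω ∂P)) + ((∑ k ∈ s N, c N k - 1) * ∫ ω, η 0 ω ∂P +
            (∫ ω, η 0 ω ∂P - ∫ ω, ξ 0 ω ∂P)) := by
        simp only [mul_sub, Finset.sum_sub_distrib]
        ring
      rw [e1, ← abs_mul]
      exact (abs_add_le _ _).trans (add_le_add (abs_add_le _ _) ((abs_add_le _ _).trans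
        (add_le_add le_rfl hm0)))
    have hI := integral_le_add_add_const i3.abs i1.abs i2.abs (Eventually.of_forall hpt)
    have hM' : (C + 1) * T < ε := hM
    linarith

end LawOfLargeNumbers

/-! ### Independence and shift invariance of the innovations. -/

section Innovations

variable {S : Type*} {Z : ℤ → S → ℝ}

/-- The σ-algebra generated by the innovations at times in `I`. -/
@[reducible]
def sig (Z : ℤ → S → ℝ) (I : Set ℤ) : MeasurableSpace S :=
  ⨆ s : I, MeasurableSpace.comap (Z s) inferInstance

lemma sig_mono {I J : Set ℤ} (h : I ⊆ J) : sig Z I ≤ sig Z J :=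
  iSup_le fun s => le_iSup (fun s : J => MeasurableSpace.comap (Z s) inferInstance) ⟨s, h s.2⟩

lemma measurable_sig {I : Set ℤ} {t : ℤ} (ht : t ∈ I) : Measurable[sig Z I] (Z t) := by
  rw [measurable_iff_comap_le]
  exact le_iSup (fun s : I => MeasurableSpace.comap (Z s) inferInstance) ⟨t, ht⟩

variable [MeasurableSpace S] {P : Measure S}

lemma sig_le (hZ : ∀ t, Measurable (Z t)) (I : Set ℤ) : sig Z I ≤ ‹MeasurableSpace S› :=
  iSup_le fun s => (hZ s).comap_le

lemma IsInnovation.indep_sig (hZ : IsInnovation P Z) {I J : Set ℤ} (h : Disjoint I J) :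
    Indep (sig Z I) (sig Z J) P := by
  have := indep_iSup_of_disjoint (fun t => (hZ.measurable t).comap_le) hZ.indep.iIndep h
  rwa [iSup_subtype', iSup_subtype'] at this

lemma IsInnovation.indepFun_of_measurable (hZ : IsInnovation P Z) {I J : Set ℤ}
    (h : Disjoint I J) {f g : S → ℝ} (hf : Measurable[sig Z I] f) (hg : Measurable[sig Z J] g) :
    IndepFun f g P := by
  rw [IndepFun_iff_Indep]
  exact indep_of_indep_of_le_left (indep_of_indep_of_le_right (hZ.indep_sig h) hg.comap_le)
    hf.comap_le

lemma IsInnovation.integrable_sq (hZ : IsInnovation P Z) (t : ℤ) :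
    Integrable (fun ω => Z t ω ^ 2) P :=
  (hZ.memLp t).integrable_sq

/-- Multiplication of a function of the past by the next squared innovation preserves
integrability and the mean. -/
lemma IsInnovation.integral_mul_sq [IsProbabilityMeasure P] (hZ : IsInnovation P Z) {t : ℤ} {f : S → ℝ}
    (hf : AEStronglyMeasurable[past Z (t - 1)] f P) (hfi : Integrable f P) :
    Integrable (fun ω => f ω * Z t ω ^ 2) P ∧ ∫ ω, f ω * Z t ω ^ 2 ∂P = ∫ ω, f ω ∂P := by
  obtain ⟨g, hg, hfg⟩ := hf
  have hd : Disjoint (Iic (t - 1)) ({t} : Set ℤ) := by simp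
  have hi : IndepFun g (fun ω => Z t ω ^ 2) P :=
    hZ.indepFun_of_measurable hd hg.measurable
      ((measurable_sig (Z := Z) (mem_singleton t)).pow_const 2)
  have hgi : Integrable g P := hfi.congr hfg
  have hmul : (fun ω => f ω * Z t ω ^ 2) =ᵐ[P] g * fun ω => Z t ω ^ 2 := by
    filter_upwards [hfg] with ω h
    rw [h, Pi.mul_apply]
  refine ⟨(hi.integrable_mul hgi (hZ.integrable_sq t)).congr hmul.symm, ?_⟩
  rw [integral_congr_ae hmul, hi.integral_mul_eq_mul_integral hgi.aestronglyMeasurable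
    (hZ.integrable_sq t).aestronglyMeasurable, hZ.secondMoment, mul_one, integral_congr_ae hfg]

/-- The law of the innovation sequence is invariant under time shifts. -/
lemma IsInnovation.identDistrib_shift [IsProbabilityMeasure P] (hZ : IsInnovation P Z) (k : ℤ) :
    IdentDistrib (fun ω t => Z (t + k) ω) (fun ω t => Z t ω) P P := by
  have h1 : iIndepFun (fun t => Z (t + k)) P := hZ.indep.precomp (add_left_injective k)
  refine ⟨(measurable_pi_lambda _ fun t => hZ.measurable _).aemeasurable,
    (measurable_pi_lambda _ fun t => hZ.measurable _).aemeasurable, ?_⟩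
  rw [(iIndepFun_iff_map_fun_eq_infinitePi_map fun t => hZ.measurable _).1 h1,
    (iIndepFun_iff_map_fun_eq_infinitePi_map fun t => hZ.measurable _).1 hZ.indep]
  congr 1
  funext t
  rw [(hZ.identDistrib _).map_eq, (hZ.identDistrib t).map_eq]

end Innovations

/-! ### Picard iterates of the stationary ARCH recursion. -/

section Picard

variable {S : Type*} {p : ℕ} {β : Fin (p + 1) → ℝ} {Z : ℤ → S → ℝ} {ρ R : ℝ}

/-- Picard iteration, started at zero, for the squared stationary ARCH process with constant
coefficients `β`. -/
def picard (β : Fin (p + 1) → ℝ) (Z : ℤ → S → ℝ) : ℕ → ℤ → S → ℝ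
  | 0, _, _ => 0
  | m + 1, k, ω => lin β (fun j => picard β Z m (k - ((j : ℤ) + 1)) ω) * Z k ω ^ 2

lemma picard_succ (β : Fin (p + 1) → ℝ) (Z : ℤ → S → ℝ) (m : ℕ) (k : ℤ) (ω : S) :
    picard β Z (m + 1) k ω = lin β (fun j => picard β Z m (k - ((j : ℤ) + 1)) ω) * Z k ω ^ 2 :=
  rfl

lemma picard_nonneg (hβ : ∀ j, 0 ≤ β j) (m : ℕ) (k : ℤ) (ω : S) : 0 ≤ picard β Z m k ω := by
  induction m generalizing k with
  | zero => exact le_rfl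
  | succ m ih =>
    exact mul_nonneg (add_nonneg (hβ 0) (Finset.sum_nonneg fun j _ => mul_nonneg (hβ _) (ih _)))
      (sq_nonneg _)

lemma lin_mono (hβ : ∀ j, 0 ≤ β j) {v v' : Fin p → ℝ} (h : ∀ j, v j ≤ v' j) :
    lin β v ≤ lin β v' :=
  add_le_add le_rfl (Finset.sum_le_sum fun j _ => mul_le_mul_of_nonneg_left (h j) (hβ _))

lemma picard_le_succ (hβ : ∀ j, 0 ≤ β j) (m : ℕ) (k : ℤ) (ω : S) :
    picard β Z m k ω ≤ picard β Z (m + 1) k ω := by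
  induction m generalizing k with
  | zero => exact picard_nonneg hβ 1 k ω
  | succ m ih => exact mul_le_mul_of_nonneg_right (lin_mono hβ fun j => ih _) (sq_nonneg _)

/-- Writes the iterate as a fixed function of the innovation path, so that shift invariance of the
law of the path passes to it. -/
lemma picard_coord (m : ℕ) (k : ℤ) (ω : S) :
    picard β Z m k ω = picard β (fun t (z : ℤ → ℝ) => z t) m k fun t => Z t ω := by
  induction m generalizing k with
  | zero => rfl
  | succ m ih => simp only [picard_succ, ih]

lemma picard_shift (m : ℕ) (i k : ℤ) (ω : S) :
    picard β (fun t => Z (t + k)) m i ω = picard β Z m (i + k) ω := by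
  induction m generalizing i with
  | zero => rfl
  | succ m ih =>
    simp only [picard_succ, ih]
    congr 2
    funext j
    congr 1
    ring

lemma measurable_lin_comp {m : MeasurableSpace S} {V : Fin p → S → ℝ}
    (hV : ∀ j, Measurable (V j)) : Measurable fun ω => lin β fun j => V j ω :=
  (measurable_lin β).comp (measurable_pi_lambda _ hV)

lemma measurable_qlik_comp {m : MeasurableSpace S} {Y : S → ℝ} {V : Fin p → S → ℝ}
    (hY : Measurable Y) (hV : ∀ j, Measurable (V j)) :
    Measurable fun ω => qlik β (Y ω) fun j => V j ω :=
  (measurable_qlik β).comp (hY.prodMk (measurable_pi_lambda _ hV))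

/-- Each iteration looks back at most p further steps. This bounded memory is the source of the
finite-range dependence. -/
lemma measurable_picard_sig (β : Fin (p + 1) → ℝ) (Z : ℤ → S → ℝ) (m : ℕ) (k : ℤ) :
    Measurable[sig Z (Icc (k - m * p) k)] (picard β Z m k) := by
  induction m generalizing k with
  | zero => exact measurable_const
  | succ m ih =>
    have h0 : (0 : ℤ) ≤ (m + 1 : ℕ) * p := by positivity
    refine Measurable.mul (measurable_lin_comp fun j => ?_)
      ((measurable_sig (right_mem_Icc.2 (by omega))).pow_const 2)
    refine (ih (k - ((j : ℤ) + 1))).mono (sig_mono (Icc_subset_Icc ?_ ?_)) le_rfl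
    · have := j.2
      push_cast
      have : ((j : ℕ) : ℤ) + 1 ≤ p := by exact_mod_cast this
      linarith
    · omega

lemma measurable_picard_past (β : Fin (p + 1) → ℝ) (Z : ℤ → S → ℝ) (m : ℕ) {k t : ℤ}
    (h : k ≤ t) : Measurable[past Z t] (picard β Z m k) :=
  (measurable_picard_sig β Z m k).mono (sig_mono fun _ hs => hs.2.trans h) le_rfl

lemma aestronglyMeasurable_lin {m m₀ : MeasurableSpace S} {P : Measure[m₀] S} {V : Fin p → S → ℝ}
    (hV : ∀ j, AEStronglyMeasurable[m] (V j) P) :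
    AEStronglyMeasurable[m] (fun ω => lin β fun j => V j ω) P := by
  choose g hg he using hV
  refine ⟨fun ω => lin β fun j => g j ω,
    (measurable_lin_comp fun j => (hg j).measurable).stronglyMeasurable, ?_⟩
  filter_upwards [ae_all_iff.2 he] with ω h
  simp only [h]

/-- The quasi-likelihood at time `k` of the `m`-th Picard iterate. -/
def picardLik (α β : Fin (p + 1) → ℝ) (Z : ℤ → S → ℝ) (m : ℕ) (k : ℤ) (ω : S) : ℝ :=
  qlik α (picard β Z (m + 1) k ω) fun j => picard β Z m (k - ((j : ℤ) + 1)) ω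

lemma measurable_picardLik_sig (α β : Fin (p + 1) → ℝ) (Z : ℤ → S → ℝ) (m : ℕ) (k : ℤ) :
    Measurable[sig Z (Icc (k - (m + 1 : ℕ) * p) k)] (picardLik α β Z m k) := by
  refine measurable_qlik_comp (measurable_picard_sig β Z (m + 1) k) fun j => ?_
  refine (measurable_picard_sig β Z m _).mono (sig_mono (Icc_subset_Icc ?_ ?_)) le_rfl
  · have : ((j : ℕ) : ℤ) + 1 ≤ p := by exact_mod_cast j.2
    push_cast
    linarith
  · omega

lemma picardLik_coord (α : Fin (p + 1) → ℝ) (m : ℕ) (k : ℤ) (ω : S) :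
    picardLik α β Z m k ω = picardLik α β (fun t (z : ℤ → ℝ) => z t) m k fun t => Z t ω := by
  simp only [picardLik, ← picard_coord]

lemma picardLik_shift (α : Fin (p + 1) → ℝ) (m : ℕ) (i k : ℤ) (ω : S) :
    picardLik α β (fun t => Z (t + k)) m i ω = picardLik α β Z m (i + k) ω := by
  simp only [picardLik, picard_shift]
  congr 1
  funext j
  congr 1
  ring

variable [MeasurableSpace S]

lemma measurable_picard (hZ : ∀ t, Measurable (Z t)) (m : ℕ) (k : ℤ) :
    Measurable (picard β Z m k) :=
  (measurable_picard_sig β Z m k).mono (sig_le hZ _) le_rfl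

lemma integrable_lin {P : Measure S} [IsFiniteMeasure P] {V : Fin p → S → ℝ}
    (hV : ∀ j, Integrable (V j) P) : Integrable (fun ω => lin β fun j => V j ω) P :=
  (integrable_const _).add (integrable_finsetSum _ fun j _ => (hV j).const_mul _)

lemma integrable_qlik {P : Measure S} [IsFiniteMeasure P] {α : Fin (p + 1) → ℝ} (hρ : 0 < ρ)
    (hα : ∀ j, α j ∈ Icc ρ R) {Y : S → ℝ} {V : Fin p → S → ℝ} (hY : Integrable Y P)
    (hV : ∀ j, Integrable (V j) P) (hV0 : ∀ j ω, 0 ≤ V j ω) :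
    Integrable (fun ω => qlik α (Y ω) fun j => V j ω) P := by
  refine Integrable.mono' ((integrable_const |qlik α 0 0|).add
    ((hY.abs.add (integrable_finsetSum Finset.univ fun j _ => hV j)).const_mul (lipConst ρ R)))
    ?_ (Eventually.of_forall fun ω => ?_)
  · exact ((measurable_qlik α).comp_aemeasurable (hY.aestronglyMeasurable.aemeasurable.prodMk
      (aemeasurable_pi_lambda _ fun j =>
        (hV j).aestronglyMeasurable.aemeasurable))).aestronglyMeasurable
  · exact abs_qlik_le hρ hα (fun j => hV0 j ω) _

lemma integral_lin {P : Measure S} [IsProbabilityMeasure P] {V : Fin p → S → ℝ}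
    (hV : ∀ j, Integrable (V j) P) :
    ∫ ω, lin β (fun j => V j ω) ∂P = lin β fun j => ∫ ω, V j ω ∂P := by
  unfold lin
  rw [integral_add (integrable_const _) (integrable_finsetSum _ fun j _ => (hV j).const_mul _),
    integral_finsetSum _ fun j _ => (hV j).const_mul _]
  simp [integral_const_mul]

lemma lin_le_of_le (hβ : ∀ j, 0 ≤ β j) {v : Fin p → ℝ} {A a K : ℝ} (h0 : β 0 ≤ a)
    (hA : ∑ j : Fin p, β j.succ ≤ A) (hK : 0 ≤ K) (hv : ∀ j, v j ≤ K) :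
    lin β v ≤ a + A * K := by
  refine add_le_add h0 ((Finset.sum_le_sum fun j _ =>
    mul_le_mul_of_nonneg_left (hv j) (hβ _)).trans ?_)
  rw [← Finset.sum_mul]
  exact mul_le_mul_of_nonneg_right hA hK

lemma IsInnovation.indepFun_picardLik {P : Measure S} (hZ : IsInnovation P Z) (α : Fin (p + 1) → ℝ) (m : ℕ)
    {k l : ℤ} (h : k + ((m + 1) * p : ℕ) < l) :
    IndepFun (picardLik α β Z m k) (picardLik α β Z m l) P := by
  refine hZ.indepFun_of_measurable ?_ (measurable_picardLik_sig α β Z m k)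
    (measurable_picardLik_sig α β Z m l)
  rw [Set.disjoint_left]
  rintro t ⟨-, h1⟩ ⟨h2, -⟩
  push_cast at h h2
  linarith

variable {P : Measure S} [IsProbabilityMeasure P]

lemma IsInnovation.integrable_picard (hZ : IsInnovation P Z) (m : ℕ) (k : ℤ) :
    Integrable (picard β Z m k) P := by
  induction m generalizing k with
  | zero => exact integrable_zero _ _ _
  | succ m ih =>
    refine (hZ.integral_mul_sq (t := k) ?_ (integrable_lin fun j => ih _)).1
    exact aestronglyMeasurable_lin fun j =>
      (measurable_picard_past β Z m (by omega)).stronglyMeasurable.aestronglyMeasurable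

lemma IsInnovation.integral_picard_succ (hZ : IsInnovation P Z) (m : ℕ) (k : ℤ) :
    ∫ ω, picard β Z (m + 1) k ω ∂P =
      lin β fun j => ∫ ω, picard β Z m (k - ((j : ℤ) + 1)) ω ∂P := by
  rw [← integral_lin fun j => hZ.integrable_picard m _]
  refine (hZ.integral_mul_sq (t := k) ?_ (integrable_lin fun j => hZ.integrable_picard m _)).2
  exact aestronglyMeasurable_lin fun j =>
    (measurable_picard_past β Z m (by omega)).stronglyMeasurable.aestronglyMeasurable

/-- The bound is the fixed point of K ↦ β₀ + A·K, so the iteration cannot cross it. -/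
lemma IsInnovation.integral_picard_le (hZ : IsInnovation P Z) (hβ : ∀ j, 0 ≤ β j) {A : ℝ}
    (hA : ∑ j : Fin p, β j.succ ≤ A) (hA1 : A < 1) (m : ℕ) (k : ℤ) :
    ∫ ω, picard β Z m k ω ∂P ≤ β 0 / (1 - A) := by
  have hA' : 0 < 1 - A := by linarith
  have hK : 0 ≤ β 0 / (1 - A) := div_nonneg (hβ 0) hA'.le
  induction m generalizing k with
  | zero => simpa [picard] using hK
  | succ m ih =>
    rw [hZ.integral_picard_succ]
    refine (lin_le_of_le hβ le_rfl hA hK fun j => ih _).trans_eq ?_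
    field_simp
    ring

lemma IsInnovation.identDistrib_picardLik (hZ : IsInnovation P Z) (α : Fin (p + 1) → ℝ) (m : ℕ)
    (k : ℤ) : IdentDistrib (picardLik α β Z m k) (picardLik α β Z m 0) P P := by
  have hm : Measurable (picardLik α β (fun t (z : ℤ → ℝ) => z t) m 0) :=
    (measurable_picardLik_sig α β _ m 0).mono (sig_le (fun t => measurable_pi_apply t) _) le_rfl
  convert (hZ.identDistrib_shift k).comp hm using 1
  · funext ω
    have := picardLik_shift (β := β) (Z := Z) α m 0 k ω
    rw [zero_add] at this
    rw [← this, picardLik_coord]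
    rfl
  · funext ω
    rw [picardLik_coord]
    rfl

lemma IsInnovation.integrable_picardLik (hZ : IsInnovation P Z) {α : Fin (p + 1) → ℝ}
    (hρ : 0 < ρ) (hα : ∀ j, α j ∈ Icc ρ R) (hβ : ∀ j, β j ∈ Icc ρ R) (m : ℕ) (k : ℤ) :
    Integrable (picardLik α β Z m k) P := by
  have hβ0 : ∀ j, 0 ≤ β j := fun j => hρ.le.trans (hβ j).1
  exact integrable_qlik hρ hα (hZ.integrable_picard _ _) (fun j => hZ.integrable_picard _ _)
    fun j => picard_nonneg hβ0 _ _

/-- The mean quasi-likelihood of a Picard iterate, in terms of the conditional variance. -/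
lemma IsInnovation.integral_picardLik (hZ : IsInnovation P Z) {α : Fin (p + 1) → ℝ}
    (hρ : 0 < ρ) (hα : ∀ j, α j ∈ Icc ρ R) (hβ : ∀ j, β j ∈ Icc ρ R) (m : ℕ) :
    ∫ ω, picardLik α β Z m 0 ω ∂P =
      ∫ ω, qlik α (lin β fun j : Fin p => picard β Z m (-((j : ℤ) + 1)) ω)
        (fun j => picard β Z m (-((j : ℤ) + 1)) ω) ∂P := by
  have hβ0 : ∀ j, 0 ≤ β j := fun j => hρ.le.trans (hβ j).1
  set V : Fin p → S → ℝ := fun j => picard β Z m (-((j : ℤ) + 1)) with hV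
  have hV0 : ∀ ω j, 0 ≤ V j ω := fun ω j => picard_nonneg hβ0 _ _ _
  have hVp : ∀ j, Measurable[past Z (0 - 1)] (V j) := fun j =>
    measurable_picard_past β Z m (by omega)
  have hVl : ∀ γ : Fin (p + 1) → ℝ, Measurable[past Z (0 - 1)] fun ω => lin γ fun j => V j ω :=
    fun γ => measurable_lin_comp hVp
  have hle : past Z (0 - 1) ≤ ‹MeasurableSpace S› := sig_le hZ.measurable _
  have hlm : Measurable fun ω => 1 / 2 * Real.log (lin α fun j => V j ω) :=
    ((Real.measurable_log.comp (hVl α)).const_mul _).mono hle le_rfl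
  have hrp : Measurable[past Z (0 - 1)] fun ω =>
      1 / 2 * ((lin β fun j => V j ω) / (lin α fun j => V j ω)) :=
    ((hVl β).div (hVl α)).const_mul _
  have hri : Integrable (fun ω => 1 / 2 * ((lin β fun j => V j ω) / (lin α fun j => V j ω))) P := by
    refine Integrable.of_bound (hrp.mono hle le_rfl).aestronglyMeasurable (1 / 2 * (R / ρ))
      (Eventually.of_forall fun ω => ?_)
    have h1 := lin_div_lin_le hρ hα hβ (hV0 ω)
    have h2 := div_nonneg (lin_pos hρ hβ (hV0 ω)).le (lin_pos hρ hα (hV0 ω)).le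
    rw [Real.norm_eq_abs, abs_of_nonneg (by positivity)]
    linarith
  obtain ⟨h1, h2⟩ := hZ.integral_mul_sq (t := 0) hrp.stronglyMeasurable.aestronglyMeasurable hri
  have e1 : ∀ ω, picardLik α β Z m 0 ω = 1 / 2 * Real.log (lin α fun j => V j ω) +
      1 / 2 * ((lin β fun j => V j ω) / (lin α fun j => V j ω)) * Z 0 ω ^ 2 := fun ω => by
    simp only [picardLik, qlik, picard_succ, zero_sub, hV]
    ring
  -- The logarithm is the quasi-likelihood minus the ratio term, and both of these are already
  -- integrable.
  have hli : Integrable (fun ω => 1 / 2 * Real.log (lin α fun j => V j ω)) P := by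
    have := (hZ.integrable_picardLik hρ hα hβ m 0).sub h1
    refine this.congr (Eventually.of_forall fun ω => ?_)
    simp only [Pi.sub_apply]
    rw [e1]
    ring
  simp only [e1]
  rw [integral_add hli h1, h2, ← integral_add hli hri]
  refine integral_congr_ae (Eventually.of_forall fun ω => ?_)
  simp only [qlik, hV]
  ring

end Picard

/-! ### Uniform coefficient bounds, moments and local stationarity. -/

/-- Uniform bounds for the coefficient functions on rescaled time. -/
structure CoeffBounds {p : ℕ} (a : Fin (p + 1) → ℝ → ℝ) (ρ R A M : ℝ) : Prop where
  pos : 0 < ρ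
  mem : ∀ u ∈ Ioc (0 : ℝ) 1, ∀ j, a j u ∈ Icc ρ R
  sum_le : ∀ u ∈ Ioc (0 : ℝ) 1, ∑ j : Fin p, a j.succ u ≤ A
  nonneg : 0 ≤ A
  lt_one : A < 1
  lip_nonneg : 0 ≤ M
  lip : ∀ u ∈ Ioc (0 : ℝ) 1, ∀ v ∈ Ioc (0 : ℝ) 1, ∀ j, |a j u - a j v| ≤ M * |u - v|

lemma RegularCoeffs.exists_coeffBounds {p : ℕ} {a : Fin (p + 1) → ℝ → ℝ} (ha : RegularCoeffs a)
    {ρ₁ ρ₂ : ℝ} (hρ₁ : 0 < ρ₁)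
    (hintg : ∀ u ∈ Ioc (0 : ℝ) 1, (fun j => a j u) ∈ interior (paramSet p ρ₁ ρ₂)) :
    ∃ A M, CoeffBounds a ρ₁ (max ρ₂ 1) A M := by
  obtain ⟨ρ, Q, M, ν, ℓ, -, hQ, hM, hν, hν1, hℓ, -, hub, hsum, hlip, hs⟩ := ha
  -- Needed for the partial sums to be bounded by the `tsum`, which would default to 0 for a
  -- divergent series.
  have hs1 : Summable fun j : ℕ => 1 / ℓ (j + 1) := by
    refine Summable.of_nonneg_of_le (fun j => (one_div_pos.2 (hℓ _)).le) (fun j => ?_)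
      ((summable_nat_add_iff 1).2 hs)
    refine div_le_div_of_nonneg_right ?_ (hℓ _).le
    push_cast
    linarith [Nat.cast_nonneg (α := ℝ) j]
  have hc : ∀ j : Fin (p + 1), 0 ≤ M / ℓ j := fun j => (div_pos hM (hℓ _)).le
  refine ⟨1 - ν, ∑ j : Fin (p + 1), M / ℓ j, hρ₁,
    fun u hu j => mem_Icc_of_mem_paramSet hρ₁ (interior_subset (hintg u hu)) j, fun u hu => ?_,
    by linarith, by linarith, Finset.sum_nonneg fun j _ => hc j, fun u hu v hv j => ?_⟩
  · refine le_trans ?_ hsum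
    calc ∑ j : Fin p, a j.succ u ≤ ∑ j : Fin p, Q * (1 / ℓ ((j : ℕ) + 1)) :=
          Finset.sum_le_sum fun j _ => by rw [mul_one_div]; exact hub j u hu
      _ = Q * ∑ j ∈ Finset.range p, 1 / ℓ (j + 1) := by
          rw [← Finset.mul_sum, Finset.sum_range]
      _ ≤ _ := mul_le_mul_of_nonneg_left
          (hs1.sum_le_tsum _ fun j _ => (one_div_pos.2 (hℓ _)).le) hQ.le
  · refine (hlip j u hu v hv).trans ?_
    rw [mul_div_right_comm]
    exact mul_le_mul_of_nonneg_right
      (Finset.single_le_sum (f := fun j : Fin (p + 1) => M / ℓ j) (fun j _ => hc j)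
        (Finset.mem_univ j)) (abs_nonneg _)

section LocalApproximation

variable {S : Type*} [MeasurableSpace S] {P : Measure S} {Z : ℤ → S → ℝ} {p : ℕ}
  {a : Fin (p + 1) → ℝ → ℝ} {X : ℕ → ℤ → S → ℝ} {ρ R A M : ℝ}

lemma div_mem_Ioc {N : ℕ} {t : ℤ} (h1 : 1 ≤ t) (h2 : t ≤ N) : (t : ℝ) / N ∈ Ioc (0 : ℝ) 1 := by
  have h3 : (0 : ℝ) < t := by exact_mod_cast (by omega : 0 < t)
  have h4 : (t : ℝ) ≤ N := by exact_mod_cast h2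
  have h5 : (0 : ℝ) < N := h3.trans_le h4
  exact ⟨div_pos h3 h5, (div_le_one h5).2 h4⟩

lemma IsTvARCH.sq_eq (hX : IsTvARCH P Z a X) (ha : CoeffBounds a ρ R A M) {N : ℕ} {t : ℤ}
    (h1 : 1 ≤ t) (h2 : t ≤ N) : ∀ᵐ ω ∂P, X N t ω ^ 2 =
      (lin (fun j => a j ((t : ℝ) / N)) fun j : Fin p => X N (t - ((j : ℤ) + 1)) ω ^ 2) *
        Z t ω ^ 2 := by
  filter_upwards [hX.recursion N t h1 h2] with ω h
  rw [h, mul_pow, condVar_eq_lin, Real.sq_sqrt]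
  exact (lin_pos ha.pos (ha.mem _ (div_mem_Ioc h1 h2)) fun j => sq_nonneg _).le

lemma IsTvARCH.aestronglyMeasurable_sq (hX : IsTvARCH P Z a X) {N : ℕ} {s t : ℤ} (hN : 1 ≤ N)
    (h1 : 1 - (p : ℤ) ≤ s) (h2 : s ≤ N) (hst : s ≤ t) :
    AEStronglyMeasurable[past Z t] (fun ω => X N s ω ^ 2) P :=
  ((hX.causal N s hN h1 h2).pow 2).mono (sig_mono (Iic_subset_Iic.2 hst))

variable [IsProbabilityMeasure P]

lemma IsTvARCH.exists_moment_bound (hX : IsTvARCH P Z a X) (hZ : IsInnovation P Z)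
    (ha : CoeffBounds a ρ R A M) :
    ∃ K : ℝ, 0 ≤ K ∧ ∀ (N : ℕ) (t : ℤ), 1 ≤ N → 1 - (p : ℤ) ≤ t → t ≤ N →
      Integrable (fun ω => X N t ω ^ 2) P ∧ ∫ ω, X N t ω ^ 2 ∂P ≤ K := by
  obtain ⟨C, hC⟩ := hX.presample
  have hA : 0 < 1 - A := by linarith [ha.lt_one]
  -- Chosen to dominate the pre-sample moments and to satisfy R + A·K ≤ K, so that the recursion
  -- preserves the bound.
  set K := max (max C 0) (R / (1 - A)) with hK
  have hK0 : 0 ≤ K := (le_max_right _ _).trans (le_max_left _ _)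
  have hKR : R + A * K ≤ K := by
    have : R / (1 - A) ≤ K := le_max_right _ _
    rw [div_le_iff₀ hA] at this
    linarith
  refine ⟨K, hK0, fun N t hN => ?_⟩
  suffices h : ∀ (n : ℕ) (t : ℤ), t ≤ 1 - (p : ℤ) + n → 1 - (p : ℤ) ≤ t → t ≤ N →
      Integrable (fun ω => X N t ω ^ 2) P ∧ ∫ ω, X N t ω ^ 2 ∂P ≤ K by
    intro h1 h2
    exact h (t - (1 - (p : ℤ))).toNat t (by omega) h1 h2
  intro n
  induction n with
  | zero =>
    intro t ht h1 h2
    rcases le_or_gt t 0 with h | h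
    · exact ⟨(hC N t hN h1 h).1,
        (hC N t hN h1 h).2.trans ((le_max_left _ _).trans (le_max_left _ _))⟩
    -- A positive time at the start of the induction occurs only without lags.
    · have hp : p = 0 := by push_cast at ht; omega
      subst hp
      have hm := ha.mem _ (div_mem_Ioc (by omega : 1 ≤ t) h2)
      have hsq := hX.sq_eq ha (by omega : 1 ≤ t) h2
      simp only [lin, Finset.univ_eq_empty, Finset.sum_empty, add_zero] at hsq
      refine ⟨((hZ.integrable_sq t).const_mul _).congr (hsq.mono fun ω h => h.symm), ?_⟩
      rw [integral_congr_ae hsq, integral_const_mul, hZ.secondMoment, mul_one]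
      refine (hm 0).2.trans (le_trans ?_ hKR)
      nlinarith [ha.nonneg]
  | succ n ih =>
    intro t ht h1 h2
    rcases le_or_gt t 0 with h | h
    · exact ⟨(hC N t hN h1 h).1,
        (hC N t hN h1 h).2.trans ((le_max_left _ _).trans (le_max_left _ _))⟩
    · have h1' : 1 ≤ t := h
      have hm := ha.mem _ (div_mem_Ioc h1' h2)
      have hlag : ∀ j : Fin p, 1 - (p : ℤ) ≤ t - ((j : ℤ) + 1) ∧ t - ((j : ℤ) + 1) ≤ N ∧
          t - ((j : ℤ) + 1) ≤ 1 - (p : ℤ) + n ∧ t - ((j : ℤ) + 1) ≤ t - 1 := fun j => by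
        have := j.2
        push_cast at ht
        omega
      have hj : ∀ j : Fin p, Integrable (fun ω => X N (t - ((j : ℤ) + 1)) ω ^ 2) P ∧
          ∫ ω, X N (t - ((j : ℤ) + 1)) ω ^ 2 ∂P ≤ K := fun j =>
        ih _ (hlag j).2.2.1 (hlag j).1 (hlag j).2.1
      have hsq := hX.sq_eq ha h1' h2
      obtain ⟨i1, i2⟩ := hZ.integral_mul_sq (t := t)
        (aestronglyMeasurable_lin (β := fun j => a j ((t : ℝ) / N))
          fun j => hX.aestronglyMeasurable_sq hN (hlag j).1 (hlag j).2.1 (hlag j).2.2.2)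
        (integrable_lin fun j => (hj j).1)
      refine ⟨i1.congr (hsq.mono fun ω h => h.symm), ?_⟩
      rw [integral_congr_ae hsq, i2, integral_lin fun j => (hj j).1]
      exact (lin_le_of_le (fun j => ha.pos.le.trans (hm j).1) (hm 0).2
        (ha.sum_le _ (div_mem_Ioc h1' h2)) hK0 fun j => (hj j).2).trans hKR

/-- Local approximation of the time-varying process by the Picard iterates of the stationary
process with coefficients frozen at `u`. -/
lemma IsTvARCH.integral_abs_sq_sub_picard_le (hX : IsTvARCH P Z a X) (hZ : IsInnovation P Z)
    (ha : CoeffBounds a ρ R A M) {K : ℝ} (hK0 : 0 ≤ K)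
    (hK : ∀ (N : ℕ) (t : ℤ), 1 ≤ N → 1 - (p : ℤ) ≤ t → t ≤ N →
      Integrable (fun ω => X N t ω ^ 2) P ∧ ∫ ω, X N t ω ^ 2 ∂P ≤ K)
    {u : ℝ} (hu : u ∈ Ioc (0 : ℝ) 1) {N : ℕ} {r : ℝ} (hr : 0 ≤ r) (m : ℕ) (k : ℤ)
    (h1 : 1 ≤ k - m * p) (h2 : k ≤ N)
    (hs : ∀ s : ℤ, k - m * p ≤ s → s ≤ k → |(s : ℝ) / N - u| ≤ r) :
    ∫ ω, |X N k ω ^ 2 - picard (fun j => a j u) Z m k ω| ∂P ≤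
      M * (1 + p * K) * r * m + A ^ m * K := by
  have hM := ha.lip_nonneg
  have hA := ha.nonneg
  induction m generalizing k with
  | zero =>
    have hk : 1 ≤ k := by simpa using h1
    simp only [picard, sub_zero, abs_sq, Nat.cast_zero, mul_zero, zero_add, pow_zero, one_mul]
    exact (hK N k (by omega) (by omega) h2).2
  | succ m ih =>
    have hmp : (0 : ℤ) ≤ (m : ℤ) * p := by positivity
    have hmp1 : ((m + 1 : ℕ) : ℤ) * p = m * p + p := by push_cast; ring
    rw [hmp1] at h1 hs
    have hk1 : 1 ≤ k := by omega
    have hN : 1 ≤ N := by omega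
    set β : Fin (p + 1) → ℝ := fun j => a j u with hβdef
    have hβ : ∀ j, β j ∈ Icc ρ R := ha.mem u hu
    have hβ0 : ∀ j, 0 ≤ β j := fun j => ha.pos.le.trans (hβ j).1
    set γ : Fin (p + 1) → ℝ := fun j => a j ((k : ℝ) / N) with hγdef
    set V : Fin p → S → ℝ := fun j ω => X N (k - ((j : ℤ) + 1)) ω ^ 2 with hV
    set V' : Fin p → S → ℝ := fun j => picard β Z m (k - ((j : ℤ) + 1)) with hV'
    have hlag : ∀ j : Fin p, 1 ≤ k - ((j : ℤ) + 1) - m * p ∧ k - ((j : ℤ) + 1) ≤ N ∧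
        k - (m * p + p) ≤ k - ((j : ℤ) + 1) - m * p ∧ k - ((j : ℤ) + 1) ≤ k - 1 := fun j => by
      have := j.2
      refine ⟨?_, ?_, ?_, ?_⟩ <;> omega
    have hVi : ∀ j, Integrable (V j) P := fun j =>
      (hK N _ hN (by have := (hlag j).1; omega) (hlag j).2.1).1
    have hVK : ∀ j, ∫ ω, V j ω ∂P ≤ K := fun j =>
      (hK N _ hN (by have := (hlag j).1; omega) (hlag j).2.1).2
    have hV'i : ∀ j, Integrable (V' j) P := fun j => hZ.integrable_picard m _
    have hVm : ∀ j, AEStronglyMeasurable[past Z (k - 1)] (V j) P := fun j =>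
      hX.aestronglyMeasurable_sq hN (by have := (hlag j).1; omega) (hlag j).2.1 (hlag j).2.2.2
    have hV'm : ∀ j, AEStronglyMeasurable[past Z (k - 1)] (V' j) P := fun j =>
      (measurable_picard_past β Z m (hlag j).2.2.2).stronglyMeasurable.aestronglyMeasurable
    set D : Fin p → ℝ := fun j => ∫ ω, |V j ω - V' j ω| ∂P with hD
    have hDle : ∀ j, D j ≤ M * (1 + p * K) * r * m + A ^ m * K := fun j =>
      ih _ (hlag j).1 (hlag j).2.1 fun s hs1 hs2 =>
        hs s (by have := (hlag j).2.2.1; omega) (by have := (hlag j).2.2.2; omega)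
    have hkr : |(k : ℝ) / N - u| ≤ r := hs k (by omega) le_rfl
    have hγβ : ∀ j, |γ j - β j| ≤ M * r := fun j =>
      (ha.lip _ (div_mem_Ioc hk1 h2) u hu j).trans (mul_le_mul_of_nonneg_left hkr hM)
    set f : S → ℝ := fun ω => (lin γ fun j => V j ω) - lin β fun j => V' j ω with hf
    have hfm : AEStronglyMeasurable[past Z (k - 1)] (fun ω => |f ω|) P := by
      obtain ⟨g, hg, he⟩ := (aestronglyMeasurable_lin (β := γ) hVm).sub
        (aestronglyMeasurable_lin (β := β) hV'm)
      exact ⟨fun ω => |g ω|, hg.norm, he.mono fun ω h => congrArg abs h⟩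
    have hfi : Integrable f P := (integrable_lin hVi).sub (integrable_lin hV'i)
    have hdi : ∀ j, Integrable (fun ω => |V j ω - V' j ω|) P := fun j =>
      ((hVi j).sub (hV'i j)).abs
    have hg1 : Integrable (fun ω => M * r * (1 + ∑ j, V j ω)) P :=
      ((integrable_const _).add (integrable_finsetSum _ fun j _ => hVi j)).const_mul _
    have hg2 : Integrable (fun ω => ∑ j, β j.succ * |V j ω - V' j ω|) P :=
      integrable_finsetSum _ fun j _ => (hdi j).const_mul _
    -- The error splits into coefficient drift, of size M·r, and the previous error weighted by the
    -- coefficients of `β`, whose sum is at most A < 1.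
    have hfle : ∀ ω, |f ω| ≤
        M * r * (1 + ∑ j, V j ω) + ∑ j, β j.succ * |V j ω - V' j ω| := fun ω => by
      refine (abs_sub_le _ (lin β fun j => V j ω) _).trans (add_le_add ?_ ?_)
      · exact abs_lin_sub_lin_param_le hγβ fun j => sq_nonneg _
      · exact abs_lin_sub_lin_le' (fun j => hβ0 _) _ _
    -- Both squares carry the same factor Z_k², independent of the past and of mean 1, so it drops
    -- out of the L¹ distance.
    have hmain : ∫ ω, |X N k ω ^ 2 - picard β Z (m + 1) k ω| ∂P = ∫ ω, |f ω| ∂P := by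
      rw [← (hZ.integral_mul_sq hfm hfi.abs).2]
      refine integral_congr_ae ((hX.sq_eq ha hk1 h2).mono fun ω hω => ?_)
      simp only [hω, picard_succ, ← sub_mul, abs_mul, abs_sq, hf, hV, hV', hγdef]
    have e1 : ∫ ω, M * r * (1 + ∑ j, V j ω) ∂P ≤ M * r * (1 + p * K) := by
      rw [integral_const_mul, integral_add (integrable_const _)
        (integrable_finsetSum _ fun j _ => hVi j), integral_finsetSum _ fun j _ => hVi j]
      simp only [integral_const, probReal_univ, smul_eq_mul, one_mul]
      refine mul_le_mul_of_nonneg_left (add_le_add le_rfl ?_) (mul_nonneg hM hr)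
      refine (Finset.sum_le_card_nsmul _ _ K fun j _ => hVK j).trans_eq ?_
      simp
    have e2 : ∫ ω, ∑ j, β j.succ * |V j ω - V' j ω| ∂P ≤
        A * (M * (1 + p * K) * r * m + A ^ m * K) := by
      rw [integral_finsetSum _ fun j _ => (hdi j).const_mul _]
      simp only [integral_const_mul]
      have h0 : 0 ≤ M * (1 + p * K) * r * m + A ^ m * K := by positivity
      refine (Finset.sum_le_sum fun j _ => mul_le_mul_of_nonneg_left (hDle j) (hβ0 _)).trans ?_
      rw [← Finset.sum_mul]
      exact mul_le_mul_of_nonneg_right (ha.sum_le u hu) h0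
    have e3 : ∫ ω, |f ω| ∂P ≤ M * r * (1 + p * K) +
        A * (M * (1 + p * K) * r * m + A ^ m * K) := by
      refine (integral_mono hfi.abs (hg1.add hg2) hfle).trans ?_
      have e4 := integral_add' hg1 hg2
      rw [e4]
      exact add_le_add e1 e2
    -- Contraction is kept only in the A^m term; for the drift A ≤ 1 suffices, and a drift bound
    -- linear in m is harmless since m stays fixed as r → 0.
    have e5 : A * (M * (1 + p * K) * r * m) ≤ 1 * (M * (1 + p * K) * r * m) :=
      mul_le_mul_of_nonneg_right ha.lt_one.le (by positivity)
    rw [hmain]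
    push_cast
    rw [pow_succ]
    linarith

lemma integrable_qlik_sq
    (hi : ∀ (N : ℕ) (t : ℤ), 1 ≤ N → 1 - (p : ℤ) ≤ t → t ≤ N →
      Integrable (fun ω => X N t ω ^ 2) P)
    {α : Fin (p + 1) → ℝ} (hρ : 0 < ρ) (hα : ∀ j, α j ∈ Icc ρ R) {N : ℕ} {k : ℤ}
    (h1 : 1 ≤ k) (h2 : k ≤ N) :
    Integrable (fun ω => qlik α (X N k ω ^ 2) fun j => X N (k - ((j : ℤ) + 1)) ω ^ 2) P := by
  have hN : 1 ≤ N := by omega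
  have hk := hi N k hN (by omega) h2
  have hj : ∀ j : Fin p, Integrable (fun ω => X N (k - ((j : ℤ) + 1)) ω ^ 2) P := fun j =>
    hi N _ hN (by have := j.2; omega) (by omega)
  exact integrable_qlik hρ hα hk hj fun j ω => sq_nonneg _

/-- The Lipschitz bound applies because iterate m + 1 is the exact ARCH value built from iterate m.
The total lag error `T` belongs to the past, so E[T(1 + Z_k²)] = 2·E[T]; this explains the factor 1
+ 2p. -/
lemma IsTvARCH.integral_abs_qlik_sub_picardLik_le (hX : IsTvARCH P Z a X)
    (hZ : IsInnovation P Z)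
    (ha : CoeffBounds a ρ R A M) {K : ℝ} (hK0 : 0 ≤ K)
    (hK : ∀ (N : ℕ) (t : ℤ), 1 ≤ N → 1 - (p : ℤ) ≤ t → t ≤ N →
      Integrable (fun ω => X N t ω ^ 2) P ∧ ∫ ω, X N t ω ^ 2 ∂P ≤ K)
    {u : ℝ} (hu : u ∈ Ioc (0 : ℝ) 1) {α : Fin (p + 1) → ℝ} (hα : ∀ j, α j ∈ Icc ρ R)
    {N : ℕ} {r : ℝ} (hr : 0 ≤ r) (m : ℕ) (k : ℤ)
    (h1 : 1 ≤ k - (m + 1 : ℕ) * p) (h2 : k ≤ N)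
    (hs : ∀ s : ℤ, k - (m + 1 : ℕ) * p ≤ s → s ≤ k → |(s : ℝ) / N - u| ≤ r) :
    ∫ ω, |qlik α (X N k ω ^ 2) (fun j => X N (k - ((j : ℤ) + 1)) ω ^ 2) -
        picardLik α (fun j => a j u) Z m k ω| ∂P ≤
      lipConst ρ R * (1 + 2 * p) * (M * (1 + p * K) * (m + 1) * r + A ^ m * K) := by
  have hM := ha.lip_nonneg
  have hA := ha.nonneg
  have hd1 := hX.integral_abs_sq_sub_picard_le hZ ha hK0 hK hu hr (m + 1) k h1 h2 hs
  have hmp : (0 : ℤ) ≤ (m : ℤ) * p := by positivity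
  have hmp1 : ((m + 1 : ℕ) : ℤ) * p = m * p + p := by push_cast; ring
  rw [hmp1] at h1 hs
  have hk1 : 1 ≤ k := by omega
  have hN : 1 ≤ N := by omega
  set β : Fin (p + 1) → ℝ := fun j => a j u with hβdef
  have hβ : ∀ j, β j ∈ Icc ρ R := ha.mem u hu
  have hβ0 : ∀ j, 0 ≤ β j := fun j => ha.pos.le.trans (hβ j).1
  have hR : 0 < R := upper_pos ha.pos hβ
  set V : Fin p → S → ℝ := fun j ω => X N (k - ((j : ℤ) + 1)) ω ^ 2 with hV
  set V' : Fin p → S → ℝ := fun j => picard β Z m (k - ((j : ℤ) + 1)) with hV'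
  have hlag : ∀ j : Fin p, 1 ≤ k - ((j : ℤ) + 1) - m * p ∧ k - ((j : ℤ) + 1) ≤ N ∧
      k - (m * p + p) ≤ k - ((j : ℤ) + 1) - m * p ∧ k - ((j : ℤ) + 1) ≤ k - 1 := fun j => by
    have := j.2
    refine ⟨?_, ?_, ?_, ?_⟩ <;> omega
  have hVi : ∀ j, Integrable (V j) P := fun j =>
    (hK N _ hN (by have := (hlag j).1; omega) (hlag j).2.1).1
  have hV'i : ∀ j, Integrable (V' j) P := fun j => hZ.integrable_picard m _
  have hVm : ∀ j, AEStronglyMeasurable[past Z (k - 1)] (V j) P := fun j =>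
    hX.aestronglyMeasurable_sq hN (by have := (hlag j).1; omega) (hlag j).2.1 (hlag j).2.2.2
  have hV'm : ∀ j, AEStronglyMeasurable[past Z (k - 1)] (V' j) P := fun j =>
    (measurable_picard_past β Z m (hlag j).2.2.2).stronglyMeasurable.aestronglyMeasurable
  set B := M * (1 + p * K) with hB
  have hB0 : 0 ≤ B := by positivity
  have hAm : A ^ (m + 1) * K ≤ A ^ m * K :=
    mul_le_mul_of_nonneg_right (pow_le_pow_of_le_one hA ha.lt_one.le (Nat.le_succ m)) hK0
  set E := B * (m + 1) * r + A ^ m * K with hE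
  have hd1' : ∫ ω, |X N k ω ^ 2 - picard β Z (m + 1) k ω| ∂P ≤ E := by
    refine hd1.trans ?_
    push_cast
    rw [hE]
    linarith
  have hd2 : ∀ j, ∫ ω, |V j ω - V' j ω| ∂P ≤ E := fun j => by
    have hj1 := (hlag j).2.2.1
    have hj2 := (hlag j).2.2.2
    refine (hX.integral_abs_sq_sub_picard_le hZ ha hK0 hK hu hr m _ (hlag j).1 (hlag j).2.1
      fun s hs1 hs2 => hs s (by omega) (by omega)).trans ?_
    rw [hE, ← hB]
    have : 0 ≤ B * r := mul_nonneg hB0 hr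
    linarith
  set T : S → ℝ := fun ω => ∑ j, |V j ω - V' j ω| with hT
  have hdi : ∀ j, Integrable (fun ω => |V j ω - V' j ω|) P := fun j =>
    ((hVi j).sub (hV'i j)).abs
  have hTi : Integrable T P := integrable_finsetSum _ fun j _ => hdi j
  have hTm : AEStronglyMeasurable[past Z (k - 1)] T P := by
    choose g hg he using hVm
    choose g' hg' he' using hV'm
    refine ⟨fun ω => ∑ j, |g j ω - g' j ω|,
      Finset.stronglyMeasurable_fun_sum _ fun j _ => ((hg j).sub (hg' j)).norm, ?_⟩
    filter_upwards [ae_all_iff.2 he, ae_all_iff.2 he'] with ω h h'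
    simp only [hT, h, h']
  have hTle : ∫ ω, T ω ∂P ≤ p * E := by
    rw [integral_finsetSum _ fun j _ => hdi j]
    refine (Finset.sum_le_card_nsmul _ _ E fun j _ => hd2 j).trans_eq ?_
    simp
  obtain ⟨hTZ, hTZ'⟩ := hZ.integral_mul_sq hTm hTi
  have hki := (hK N k hN (by omega) h2).1
  have hyi : Integrable (fun ω => |X N k ω ^ 2 - picard β Z (m + 1) k ω|) P :=
    (hki.sub (hZ.integrable_picard (m + 1) k)).abs
  have hq := integrable_qlik_sq (fun N t x y z => (hK N t x y z).1) ha.pos hα hk1 h2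
  have hq' := hZ.integrable_picardLik (Z := Z) ha.pos hα hβ m k
  have hpt : ∀ ω, |qlik α (X N k ω ^ 2) (fun j => V j ω) - picardLik α β Z m k ω| ≤
      lipConst ρ R * |X N k ω ^ 2 - picard β Z (m + 1) k ω| +
        lipConst ρ R * (T ω + T ω * Z k ω ^ 2) + 0 := fun ω => by
    refine (abs_qlik_sub_qlik_le ha.pos hα hβ (fun j => sq_nonneg _)
      (fun j => picard_nonneg hβ0 m _ ω) (X N k ω ^ 2) (sq_nonneg (Z k ω))).trans_eq ?_
    simp only [hT, hV, hV', picard_succ]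
    ring
  have hfin := integral_le_add_add_const (hq.sub hq').abs (hyi.const_mul (lipConst ρ R))
    ((hTi.add hTZ).const_mul (lipConst ρ R)) (Eventually.of_forall hpt)
  refine hfin.trans ?_
  rw [integral_const_mul, integral_const_mul]
  have e := integral_add' hTi hTZ
  have e' : ∫ ω, (T + fun ω => T ω * Z k ω ^ 2) ω ∂P ≤ 2 * (p * E) := by
    rw [e, hTZ']; linarith
  have hL := lipConst_pos ha.pos hR
  calc _ ≤ lipConst ρ R * E + lipConst ρ R * (2 * (p * E)) + 0 :=
        add_le_add (add_le_add (mul_le_mul_of_nonneg_left hd1' hL.le)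
          (mul_le_mul_of_nonneg_left e' hL.le)) le_rfl
    _ = _ := by ring

end LocalApproximation

open scoped ENNReal

/-! ### The stationary process, identifiability and the limit contrast. -/

section Stationary

variable {S : Type*} {p : ℕ} {α β : Fin (p + 1) → ℝ} {Z : ℤ → S → ℝ} {ρ R A : ℝ}

/-- The squared stationary ARCH process with constant coefficients `β`, as the monotone limit of
the Picard iterates. -/
def statSq (β : Fin (p + 1) → ℝ) (Z : ℤ → S → ℝ) (k : ℤ) (ω : S) : ℝ :=
  (⨆ m, ENNReal.ofReal (picard β Z m k ω)).toReal

lemma statSq_nonneg (k : ℤ) (ω : S) : 0 ≤ statSq β Z k ω := ENNReal.toReal_nonneg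

/-- The supremum in `ENNReal` gives measurability with respect to the past itself, not merely up to
null sets; where it is infinite, `toReal` yields 0. -/
lemma measurable_statSq_past (β : Fin (p + 1) → ℝ) (Z : ℤ → S → ℝ) {k t : ℤ} (h : k ≤ t) :
    Measurable[past Z t] (statSq β Z k) :=
  (Measurable.iSup fun m => (measurable_picard_past β Z m h).ennreal_ofReal).ennreal_toReal

variable [MeasurableSpace S] {P : Measure S} [IsProbabilityMeasure P]

/-- Monotone convergence with the uniform bound on the means of the iterates. -/
lemma IsInnovation.lintegral_iSup_picard_ne_top (hZ : IsInnovation P Z) (hβ : ∀ j, 0 ≤ β j)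
    (hA : ∑ j : Fin p, β j.succ ≤ A) (hA1 : A < 1) (k : ℤ) :
    ∫⁻ ω, ⨆ m, ENNReal.ofReal (picard β Z m k ω) ∂P ≠ ∞ := by
  rw [lintegral_iSup (fun m => (measurable_picard hZ.measurable m k).ennreal_ofReal)
    (monotone_nat_of_le_succ fun m ω => ENNReal.ofReal_le_ofReal (picard_le_succ hβ m k ω))]
  refine ne_top_of_le_ne_top (ENNReal.ofReal_ne_top (r := β 0 / (1 - A))) (iSup_le fun m => ?_)
  rw [← ofReal_integral_eq_lintegral_ofReal (hZ.integrable_picard m k)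
    (Eventually.of_forall fun ω => picard_nonneg hβ m k ω)]
  exact ENNReal.ofReal_le_ofReal (hZ.integral_picard_le hβ hA hA1 m k)

lemma IsInnovation.integrable_statSq (hZ : IsInnovation P Z) (hβ : ∀ j, 0 ≤ β j)
    (hA : ∑ j : Fin p, β j.succ ≤ A) (hA1 : A < 1) (k : ℤ) : Integrable (statSq β Z k) P :=
  integrable_toReal_of_lintegral_ne_top
    (Measurable.iSup fun m =>
      (measurable_picard hZ.measurable m k).ennreal_ofReal).aemeasurable
    (hZ.lintegral_iSup_picard_ne_top hβ hA hA1 k)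

lemma IsInnovation.ae_tendsto_picard (hZ : IsInnovation P Z) (hβ : ∀ j, 0 ≤ β j)
    (hA : ∑ j : Fin p, β j.succ ≤ A) (hA1 : A < 1) :
    ∀ᵐ ω ∂P, ∀ k, Tendsto (fun m => picard β Z m k ω) atTop (𝓝 (statSq β Z k ω)) ∧
      ∀ m, picard β Z m k ω ≤ statSq β Z k ω := by
  rw [ae_all_iff]
  intro k
  filter_upwards [ae_lt_top (Measurable.iSup fun m =>
    (measurable_picard hZ.measurable m k).ennreal_ofReal)
    (hZ.lintegral_iSup_picard_ne_top hβ hA hA1 k)] with ω hω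
  have e : ∀ m, (ENNReal.ofReal (picard β Z m k ω)).toReal = picard β Z m k ω := fun m =>
    ENNReal.toReal_ofReal (picard_nonneg hβ m k ω)
  constructor
  · have h1 : Tendsto (fun m => ENNReal.ofReal (picard β Z m k ω)) atTop
        (𝓝 (⨆ m, ENNReal.ofReal (picard β Z m k ω))) :=
      tendsto_atTop_iSup (monotone_nat_of_le_succ fun m =>
        ENNReal.ofReal_le_ofReal (picard_le_succ hβ m k ω))
    exact ((ENNReal.tendsto_toReal hω.ne).comp h1).congr e
  · intro m
    rw [← e m]
    exact ENNReal.toReal_mono hω.ne (le_iSup (fun m => ENNReal.ofReal (picard β Z m k ω)) m)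

lemma IsInnovation.ae_statSq_eq (hZ : IsInnovation P Z) (hβ : ∀ j, 0 ≤ β j)
    (hA : ∑ j : Fin p, β j.succ ≤ A) (hA1 : A < 1) :
    ∀ᵐ ω ∂P, ∀ k, statSq β Z k ω =
      lin β (fun j => statSq β Z (k - ((j : ℤ) + 1)) ω) * Z k ω ^ 2 := by
  filter_upwards [hZ.ae_tendsto_picard hβ hA hA1] with ω hω k
  refine tendsto_nhds_unique ((hω k).1.comp (tendsto_add_atTop_nat 1)) ?_
  refine Tendsto.mul_const (Z k ω ^ 2) (Tendsto.const_add _ ?_)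
  exact tendsto_finsetSum _ fun j _ => ((hω _).1).const_mul _

lemma IsInnovation.tendsto_integral_abs_statSq_sub_picard (hZ : IsInnovation P Z)
    (hβ : ∀ j, 0 ≤ β j) (hA : ∑ j : Fin p, β j.succ ≤ A) (hA1 : A < 1) (k : ℤ) :
    Tendsto (fun m => ∫ ω, |statSq β Z k ω - picard β Z m k ω| ∂P) atTop (𝓝 0) := by
  have hi := hZ.integrable_statSq hβ hA hA1 k
  rw [← integral_zero S ℝ (μ := P)]
  refine tendsto_integral_of_dominated_convergence (statSq β Z k) (fun m => ?_) hi
    (fun m => ?_) ?_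
  · exact (hi.sub (hZ.integrable_picard m k)).abs.aestronglyMeasurable
  · filter_upwards [hZ.ae_tendsto_picard hβ hA hA1] with ω hω
    have h1 := (hω k).2 m
    have h2 := picard_nonneg (Z := Z) hβ m k ω
    rw [Real.norm_eq_abs, abs_abs, abs_of_nonneg (by linarith)]
    linarith
  · filter_upwards [hZ.ae_tendsto_picard hβ hA hA1] with ω hω
    simpa using ((hω k).1.const_sub (statSq β Z k ω)).abs

/-- The expected quasi-likelihood of the stationary ARCH process with coefficients `β` at the
parameter `α`. -/
def meanLik (P : Measure S) (Z : ℤ → S → ℝ) (β α : Fin (p + 1) → ℝ) : ℝ :=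
  ∫ ω, qlik α (lin β fun j : Fin p => statSq β Z (-((j : ℤ) + 1)) ω)
    (fun j => statSq β Z (-((j : ℤ) + 1)) ω) ∂P

lemma IsInnovation.integrable_qlik_statSq (hZ : IsInnovation P Z) (hρ : 0 < ρ)
    (hα : ∀ j, α j ∈ Icc ρ R) (hβ : ∀ j, 0 ≤ β j) (hA : ∑ j : Fin p, β j.succ ≤ A)
    (hA1 : A < 1) :
    Integrable (fun ω => qlik α (lin β fun j : Fin p => statSq β Z (-((j : ℤ) + 1)) ω)
      (fun j => statSq β Z (-((j : ℤ) + 1)) ω)) P :=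
  integrable_qlik hρ hα (integrable_lin fun _ => hZ.integrable_statSq hβ hA hA1 _)
    (fun _ => hZ.integrable_statSq hβ hA hA1 _) fun _ _ => statSq_nonneg _ _

lemma IsInnovation.tendsto_integral_picardLik (hZ : IsInnovation P Z) (hρ : 0 < ρ)
    (hα : ∀ j, α j ∈ Icc ρ R) (hβ : ∀ j, β j ∈ Icc ρ R) (hA : ∑ j : Fin p, β j.succ ≤ A)
    (hA1 : A < 1) :
    Tendsto (fun m => ∫ ω, picardLik α β Z m 0 ω ∂P) atTop (𝓝 (meanLik P Z β α)) := by
  have hβ0 : ∀ j, 0 ≤ β j := fun j => hρ.le.trans (hβ j).1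
  have hR : 0 < R := upper_pos hρ hβ
  have hL := lipConst_pos hρ hR
  set V : Fin p → S → ℝ := fun j => statSq β Z (-((j : ℤ) + 1)) with hV
  set U : ℕ → Fin p → S → ℝ := fun m j => picard β Z m (-((j : ℤ) + 1)) with hU
  have hVi : ∀ j, Integrable (V j) P := fun j => hZ.integrable_statSq hβ0 hA hA1 _
  have hUi : ∀ m j, Integrable (U m j) P := fun m j => hZ.integrable_picard m _
  have hdi : ∀ m j, Integrable (fun ω => |V j ω - U m j ω|) P := fun m j =>
    ((hVi j).sub (hUi m j)).abs
  have hq := hZ.integrable_qlik_statSq hρ hα hβ0 hA hA1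
  have hq' : ∀ m, Integrable (fun ω => qlik α (lin β fun j => U m j ω) fun j => U m j ω) P :=
    fun m => integrable_qlik hρ hα (integrable_lin (hUi m)) (hUi m)
      fun j ω => picard_nonneg hβ0 _ _ _
  rw [tendsto_iff_dist_tendsto_zero]
  refine squeeze_zero (fun m => dist_nonneg)
    (g := fun m => lipConst ρ R * (R + 2) * ∑ j, ∫ ω, |V j ω - U m j ω| ∂P) (fun m => ?_) ?_
  · rw [dist_comm, Real.dist_eq, hZ.integral_picardLik hρ hα hβ m, meanLik,
      ← integral_sub hq (hq' m), ← integral_finsetSum _ fun j _ => hdi m j, ← integral_const_mul]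
    refine abs_integral_le_integral_abs.trans (integral_mono (hq.sub (hq' m)).abs
      ((integrable_finsetSum _ fun j _ => hdi m j).const_mul _) fun ω => ?_)
    -- Once the innovation has been integrated out, the observation is `lin β` itself, that is `z =
    -- 1`. In the constant R + 2, the R comes from `lin β` and the 2 is 1 + z.
    have h1 := abs_qlik_sub_qlik_le hρ hα hβ (v := fun j => V j ω) (v' := fun j => U m j ω)
      (fun j => statSq_nonneg _ _) (fun j => picard_nonneg hβ0 _ _ _)
      (lin β fun j => V j ω) zero_le_one
    have h2 := abs_lin_sub_lin_le hρ hβ (fun j => V j ω) fun j => U m j ω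
    rw [mul_one] at h1
    refine h1.trans ?_
    rw [mul_assoc]
    refine mul_le_mul_of_nonneg_left ?_ hL.le
    linarith
  · have : Tendsto (fun m => ∑ j, ∫ ω, |V j ω - U m j ω| ∂P) atTop (𝓝 (∑ _j : Fin p, 0)) :=
      tendsto_finsetSum _ fun j _ => hZ.tendsto_integral_abs_statSq_sub_picard hβ0 hA hA1 _
    simpa using this.const_mul (lipConst ρ R * (R + 2))

/-- Supplies the continuity from which compactness extracts a positive gap. -/
lemma IsInnovation.abs_meanLik_sub_meanLik_le (hZ : IsInnovation P Z) (hρ : 0 < ρ)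
    {α' : Fin (p + 1) → ℝ} (hα : ∀ j, α j ∈ Icc ρ R) (hα' : ∀ j, α' j ∈ Icc ρ R)
    (hβ : ∀ j, β j ∈ Icc ρ R) (hA : ∑ j : Fin p, β j.succ ≤ A) (hA1 : A < 1) :
    |meanLik P Z β α - meanLik P Z β α'| ≤ lipConst ρ R *
      (1 + ∫ ω, lin β (fun j : Fin p => statSq β Z (-((j : ℤ) + 1)) ω) ∂P) * dist α α' := by
  have hβ0 : ∀ j, 0 ≤ β j := fun j => hρ.le.trans (hβ j).1
  have hq := hZ.integrable_qlik_statSq hρ hα hβ0 hA hA1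
  have hq' := hZ.integrable_qlik_statSq hρ hα' hβ0 hA hA1
  have hli : Integrable (fun ω => lin β fun j : Fin p => statSq β Z (-((j : ℤ) + 1)) ω) P :=
    integrable_lin fun _ => hZ.integrable_statSq hβ0 hA hA1 _
  rw [meanLik, meanLik, ← integral_sub hq hq']
  refine abs_integral_le_integral_abs.trans ((integral_mono (hq.sub hq').abs
    (((integrable_const 1).add hli).const_mul (lipConst ρ R * dist α α')) fun ω => ?_).trans_eq ?_)
  · exact abs_qlik_sub_qlik_param_le hρ hα hα' (fun j => statSq_nonneg _ _)
      (lin_pos hρ hβ fun j => statSq_nonneg _ _).le fun j => by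
        rw [← Real.dist_eq]; exact dist_le_pi_dist α α' j
  · have e := integral_add' (integrable_const (μ := P) (1 : ℝ)) hli
    rw [integral_const_mul, e, integral_const, probReal_univ, one_smul]
    ring

/-- If a squared innovation is a function of the past, it is constant. -/
lemma IsInnovation.ae_sq_eq_one (hZ : IsInnovation P Z) {t : ℤ} {H : S → ℝ}
    (hH : Measurable[past Z (t - 1)] H) (h : ∀ᵐ ω ∂P, Z t ω ^ 2 = H ω) :
    ∀ᵐ ω ∂P, Z 0 ω ^ 2 = 1 := by
  have hd : Disjoint (Iic (t - 1)) ({t} : Set ℤ) := by simp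
  have hi : IndepFun H (fun ω => Z t ω ^ 2) P :=
    hZ.indepFun_of_measurable hd hH ((measurable_sig (Z := Z) (mem_singleton t)).pow_const 2)
  have hXX : IndepFun (fun ω => Z t ω ^ 2) (fun ω => Z t ω ^ 2) P :=
    hi.congr (h.mono fun ω hω => hω.symm) (EventuallyEq.refl _ _)
  have hintg := hZ.integrable_sq t
  -- A finite fourth moment is not assumed: it follows from Z_t² being independent of itself, and
  -- then Z_t² has variance zero.
  have h1 := hXX.integrable_mul hintg hintg
  have h2 := hXX.integral_mul_eq_mul_integral hintg.aestronglyMeasurable hintg.aestronglyMeasurable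
  rw [hZ.secondMoment, mul_one] at h2
  have e : ∀ ω, (Z t ω ^ 2 - 1) ^ 2 =
      ((fun ω => Z t ω ^ 2) * fun ω => Z t ω ^ 2) ω - (2 * Z t ω ^ 2 - 1) := fun ω => by
    simp only [Pi.mul_apply]; ring
  have h3i : Integrable (fun ω => 2 * Z t ω ^ 2 - 1) P :=
    (hintg.const_mul 2).sub (integrable_const 1)
  have h3 : ∫ ω, (Z t ω ^ 2 - 1) ^ 2 ∂P = 0 := by
    simp only [e]
    rw [integral_sub h1 h3i, h2, integral_sub (hintg.const_mul 2) (integrable_const 1),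
      integral_const_mul, hZ.secondMoment]
    simp
    norm_num
  have h4i : Integrable (fun ω => (Z t ω ^ 2 - 1) ^ 2) P := by
    simp only [e]
    exact h1.sub h3i
  rw [integral_eq_zero_iff_of_nonneg (fun ω => sq_nonneg _) h4i] at h3
  have h5 : ∀ᵐ ω ∂P, Z t ω ^ 2 = 1 := h3.mono fun ω hω => by
    have : (Z t ω ^ 2 - 1) ^ 2 = 0 := hω
    have := pow_eq_zero_iff (two_ne_zero) |>.1 this
    linarith
  exact (hZ.identDistrib t).ae_snd (p := fun x : ℝ => x ^ 2 = 1)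
    (measurableSet_eq_fun (by fun_prop) (by fun_prop)) h5

/-- The ARCH parameters are identified by the conditional variance of the stationary process. -/
lemma IsInnovation.eq_of_ae_lin_eq (hZ : IsInnovation P Z)
    (hnd : ¬ ∀ᵐ ω ∂P, Z 0 ω ^ 2 = 1) (hρ : 0 < ρ) (hβ : ∀ j, β j ∈ Icc ρ R)
    (hA : ∑ j : Fin p, β j.succ ≤ A) (hA1 : A < 1)
    (h : ∀ᵐ ω ∂P, lin α (fun j : Fin p => statSq β Z (-((j : ℤ) + 1)) ω) =
      lin β fun j : Fin p => statSq β Z (-((j : ℤ) + 1)) ω) : α = β := by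
  have hβ0 : ∀ j, 0 ≤ β j := fun j => hρ.le.trans (hβ j).1
  set c : Fin (p + 1) → ℝ := fun j => α j - β j with hc
  have hlin : ∀ᵐ ω ∂P, c 0 + ∑ j : Fin p, c j.succ * statSq β Z (-((j : ℤ) + 1)) ω = 0 := by
    filter_upwards [h] with ω hω
    simp only [lin] at hω
    simp only [hc, sub_mul, Finset.sum_sub_distrib]
    linarith
  have hsucc : ∀ j : Fin p, c j.succ = 0 := by
    by_contra hne
    push Not at hne
    -- The smallest such lag is the most recent time `t`, so every other term with nonzero
    -- coefficient lies strictly before `t`. Solving gives `statSq` at `t` as `G`, and Z_t² = G/w is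
    -- then a function of the past.
    obtain ⟨j, hj, hmin⟩ : ∃ j : Fin p, c j.succ ≠ 0 ∧ ∀ i, i < j → c i.succ = 0 := by
      obtain ⟨j, hj, hmin⟩ := WellFounded.has_min (wellFounded_lt (α := Fin p))
        {j | c j.succ ≠ 0} hne
      exact ⟨j, hj, fun i hi => by_contra fun hi' => hmin i hi' hi⟩
    set t : ℤ := -((j : ℤ) + 1) with ht
    set G : S → ℝ := fun ω => -(c 0 + ∑ i ∈ Finset.univ.filter (fun i : Fin p => j < i),
      c i.succ * statSq β Z (-((i : ℤ) + 1)) ω) / c j.succ with hG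
    set w : S → ℝ := fun ω => lin β fun i : Fin p => statSq β Z (t - ((i : ℤ) + 1)) ω with hw
    have hGm : Measurable[past Z (t - 1)] G := by
      refine ((Measurable.const_add (Finset.measurable_fun_sum _ fun i hi => ?_) _).neg).div_const _
      have hij : ((j : ℕ) : ℤ) < i := by exact_mod_cast (Finset.mem_filter.1 hi).2
      exact (measurable_statSq_past β Z (by omega)).const_mul _
    have hwm : Measurable[past Z (t - 1)] w :=
      measurable_lin_comp fun i => measurable_statSq_past β Z (by omega)
    refine hnd (hZ.ae_sq_eq_one (t := t) (hGm.div hwm) ?_)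
    filter_upwards [hlin, hZ.ae_statSq_eq hβ0 hA hA1] with ω h1 h2
    have hwpos : 0 < w ω := lin_pos hρ hβ fun i => statSq_nonneg _ _
    have h3 := h2 t
    have h4 : ∑ i : Fin p, c i.succ * statSq β Z (-((i : ℤ) + 1)) ω =
        c j.succ * statSq β Z t ω + ∑ i ∈ Finset.univ.filter (fun i : Fin p => j < i),
          c i.succ * statSq β Z (-((i : ℤ) + 1)) ω := by
      rw [← Finset.add_sum_erase _ _ (Finset.mem_univ j), add_right_inj]
      refine (Finset.sum_subset (fun i hi => ?_) fun i hi hi' => ?_).symm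
      · exact Finset.mem_erase.2 ⟨(Finset.mem_filter.1 hi).2.ne', Finset.mem_univ i⟩
      · rcases lt_trichotomy i j with hlt | heq | hgt
        · rw [hmin i hlt, zero_mul]
        · exact absurd heq (Finset.mem_erase.1 hi).1
        · exact absurd (Finset.mem_filter.2 ⟨Finset.mem_univ i, hgt⟩) hi'
    rw [h4] at h1
    have h5 : statSq β Z t ω = G ω := by
      rw [hG, eq_div_iff hj]
      linarith
    simp only [Pi.div_apply]
    rw [eq_div_iff hwpos.ne', ← h5, h3, mul_comm]
  have hzero : c 0 = 0 := by
    obtain ⟨ω, hω⟩ := hlin.exists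
    simpa [hsucc] using hω
  funext j
  have : c j = 0 := Fin.cases hzero hsucc j
  exact sub_eq_zero.1 this

/-- The expected quasi-likelihood is uniquely minimized at the true parameter. -/
lemma IsInnovation.meanLik_lt (hZ : IsInnovation P Z)
    (hnd : ¬ ∀ᵐ ω ∂P, Z 0 ω ^ 2 = 1) (hρ : 0 < ρ) (hα : ∀ j, α j ∈ Icc ρ R)
    (hβ : ∀ j, β j ∈ Icc ρ R) (hA : ∑ j : Fin p, β j.succ ≤ A) (hA1 : A < 1) (hne : α ≠ β) :
    meanLik P Z β β < meanLik P Z β α := by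
  have hβ0 : ∀ j, 0 ≤ β j := fun j => hρ.le.trans (hβ j).1
  have hq := hZ.integrable_qlik_statSq hρ hα hβ0 hA hA1
  have hq' := hZ.integrable_qlik_statSq hρ hβ hβ0 hA hA1
  refine lt_of_le_of_ne (integral_mono hq' hq fun ω =>
    qlik_lin_le hρ hα hβ fun j => statSq_nonneg _ _) fun heq => hne ?_
  refine hZ.eq_of_ae_lin_eq hnd hρ hβ hA hA1 ?_
  have h0 := (integral_eq_zero_iff_of_nonneg (fun ω => sub_nonneg.2
    (qlik_lin_le hρ hα hβ fun j => statSq_nonneg _ _)) (hq.sub hq')).1 (by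
      exact (integral_sub' hq hq').trans (sub_eq_zero.2 heq.symm))
  filter_upwards [h0] with ω hω
  exact lin_eq_of_qlik_eq hρ hα hβ (fun j => statSq_nonneg _ _) (sub_eq_zero.1 hω)

end Stationary

/-! ### The smoothing window in rescaled time. -/

section Bandwidth

variable {u₀ : ℝ} {t₀ : ℕ → ℕ} {b : ℕ → ℝ}

lemma abs_mul_sub_lt_one (ht₀ : ∀ N : ℕ, 1 ≤ N → |u₀ - (t₀ N : ℝ) / N| < 1 / N) {N : ℕ}
    (hN : 1 ≤ N) : |N * u₀ - t₀ N| < 1 := by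
  have h0 : (0 : ℝ) < N := by exact_mod_cast hN
  have h := ht₀ N hN
  rw [lt_div_iff₀ h0] at h
  have e : N * u₀ - t₀ N = (u₀ - (t₀ N : ℝ) / N) * N := by field_simp
  rwa [e, abs_mul, abs_of_pos h0]

/-- Since t₀ ~ u₀N with u₀ > 0 while the half-width is o(N), the window stays away from any fixed
number of initial times. -/
lemma eventually_add_half_le (hu₀ : u₀ ∈ Ioo (0 : ℝ) 1)
    (ht₀ : ∀ N : ℕ, 1 ≤ N → |u₀ - (t₀ N : ℝ) / N| < 1 / N) (hb : Tendsto b atTop (𝓝 0)) (c : ℝ) :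
    ∀ᶠ N : ℕ in atTop, c + b N * N / 2 ≤ t₀ N := by
  have h1 : Tendsto (fun N : ℕ => u₀ / 2 * (N : ℝ)) atTop atTop :=
    tendsto_natCast_atTop_atTop.const_mul_atTop (half_pos hu₀.1)
  filter_upwards [eventually_ge_atTop 1, hb.eventually_lt_const hu₀.1,
    h1.eventually_ge_atTop (c + 1)] with N hN hbu hc
  have h2 := abs_mul_sub_lt_one ht₀ hN
  rw [abs_lt] at h2
  have h3 : b N * N ≤ u₀ * N := mul_le_mul_of_nonneg_right hbu.le (Nat.cast_nonneg N)
  linarith [h2.2]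

lemma eventually_add_half_le_self (hu₀ : u₀ ∈ Ioo (0 : ℝ) 1)
    (ht₀ : ∀ N : ℕ, 1 ≤ N → |u₀ - (t₀ N : ℝ) / N| < 1 / N) (hb : Tendsto b atTop (𝓝 0)) :
    ∀ᶠ N : ℕ in atTop, (t₀ N : ℝ) + b N * N / 2 ≤ N := by
  have h0 : 0 < 1 - u₀ := by linarith [hu₀.2]
  have h1 : Tendsto (fun N : ℕ => (1 - u₀) / 2 * (N : ℝ)) atTop atTop :=
    tendsto_natCast_atTop_atTop.const_mul_atTop (half_pos h0)
  filter_upwards [eventually_ge_atTop 1, hb.eventually_lt_const h0,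
    h1.eventually_ge_atTop 1] with N hN hbu hc
  have h2 := abs_mul_sub_lt_one ht₀ hN
  rw [abs_lt] at h2
  have h3 : b N * N ≤ (1 - u₀) * N := mul_le_mul_of_nonneg_right hbu.le (Nat.cast_nonneg N)
  linarith [h2.1]

lemma abs_div_sub_le_of_mem_window (ht₀ : ∀ N : ℕ, 1 ≤ N → |u₀ - (t₀ N : ℝ) / N| < 1 / N)
    {N q k : ℕ} (hN : 1 ≤ N) (hk : |(t₀ N : ℝ) - k| ≤ b N * N / 2) {s : ℤ}
    (h1 : (k : ℤ) - q ≤ s) (h2 : s ≤ k) : |(s : ℝ) / N - u₀| ≤ |b N| / 2 + (q + 1 : ℝ) / N := by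
  have h0 : (0 : ℝ) < N := by exact_mod_cast hN
  have ht := abs_mul_sub_lt_one ht₀ hN
  have h1' : (k : ℝ) - q ≤ s := by exact_mod_cast h1
  have h2' : (s : ℝ) ≤ k := by exact_mod_cast h2
  have hbb : b N * N ≤ |b N| * N := mul_le_mul_of_nonneg_right (le_abs_self _) h0.le
  have e : (s : ℝ) / N - u₀ = (s - N * u₀) / N := by field_simp
  have e' : |b N| / 2 + (q + 1 : ℝ) / N = (|b N| * N / 2 + q + 1) / N := by field_simp; ring
  rw [e, e', abs_div, abs_of_pos h0]
  refine div_le_div_of_nonneg_right ?_ h0.le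
  have hq : (0 : ℝ) ≤ q := Nat.cast_nonneg q
  rw [abs_le] at *
  rw [abs_lt] at ht
  constructor <;> linarith [ht.1, ht.2, hk.1, hk.2]

end Bandwidth

/-! ### Convergence of the local quasi-likelihood and equicontinuity. -/

section Consistency

variable {S : Type*} [MeasurableSpace S] {P : Measure S} [IsProbabilityMeasure P]
  {p : ℕ} {Z : ℤ → S → ℝ} {a : Fin (p + 1) → ℝ → ℝ} {X : ℕ → ℤ → S → ℝ} {ρ R A M K : ℝ}
  {W : ℝ → ℝ} {u₀ : ℝ} {t₀ : ℕ → ℕ} {b : ℕ → ℝ}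

lemma integrable_weightedLik
    (hK : ∀ (N : ℕ) (t : ℤ), 1 ≤ N → 1 - (p : ℤ) ≤ t → t ≤ N →
      Integrable (fun ω => X N t ω ^ 2) P)
    {α : Fin (p + 1) → ℝ} (hρ : 0 < ρ) (hα : ∀ j, α j ∈ Icc ρ R) (b : ℝ) (t₀ N : ℕ) :
    Integrable (fun ω => weightedLik W b t₀ (fun n t => X n t ω) N α) P := by
  simp only [weightedLik_eq, quasiLik_eq_qlik]
  refine integrable_finsetSum _ fun k hk => Integrable.const_mul ?_ _
  rw [Finset.mem_Icc] at hk
  exact integrable_qlik_sq hK hρ hα (by omega) (by omega)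

/-- Pointwise convergence in `L¹` of the local quasi-likelihood. -/
lemma IsTvARCH.tendsto_integral_abs_weightedLik_sub (hX : IsTvARCH P Z a X)
    (hZ : IsInnovation P Z) (ha : CoeffBounds a ρ R A M) (hK0 : 0 ≤ K)
    (hK : ∀ (N : ℕ) (t : ℤ), 1 ≤ N → 1 - (p : ℤ) ≤ t → t ≤ N →
      Integrable (fun ω => X N t ω ^ 2) P ∧ ∫ ω, X N t ω ^ 2 ∂P ≤ K)
    (hW : IsKernel W) (hu₀ : u₀ ∈ Ioo (0 : ℝ) 1)
    (ht₀ : ∀ N : ℕ, 1 ≤ N → |u₀ - (t₀ N : ℝ) / N| < 1 / N) (hb : Tendsto b atTop (𝓝 0))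
    (hbN : Tendsto (fun N : ℕ => b N * N) atTop atTop)
    {α : Fin (p + 1) → ℝ} (hα : ∀ j, α j ∈ Icc ρ R) :
    Tendsto (fun N => ∫ ω, |weightedLik W (b N) (t₀ N) (fun n t => X n t ω) N α -
      meanLik P Z (fun j => a j u₀) α| ∂P) atTop (𝓝 0) := by
  have hu : u₀ ∈ Ioc (0 : ℝ) 1 := ⟨hu₀.1, hu₀.2.le⟩
  set β : Fin (p + 1) → ℝ := fun j => a j u₀ with hβdef
  have hβ : ∀ j, β j ∈ Icc ρ R := ha.mem u₀ hu
  have hρ := ha.pos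
  have hM := ha.lip_nonneg
  have hA0 := ha.nonneg
  have hL := lipConst_pos hρ (upper_pos hρ hβ)
  obtain ⟨Kw, hKw0, hKw⟩ := exists_abs_le_of_boundedVariationOn hW.boundedVariation
  set L := lipConst ρ R * (1 + 2 * p) with hLdef
  have hL0 : 0 ≤ L := by positivity
  refine tendsto_zero_of_forall_le_add (fun N => integral_nonneg fun ω => abs_nonneg _)
    fun ε hε => ?_
  -- The depth `m` is fixed here: it makes small both the memory cut off by the iterate and the gap
  -- between its mean and the limit contrast.
  obtain ⟨m, hm⟩ : ∃ m : ℕ, 4 * Kw * (L * (A ^ m * K)) +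
      |∫ ω, picardLik α β Z m 0 ω ∂P - meanLik P Z β α| < ε := by
    have t1 := (((tendsto_pow_atTop_nhds_zero_of_lt_one hA0 ha.lt_one).mul_const K).const_mul
      L).const_mul (4 * Kw)
    have t2 := ((hZ.tendsto_integral_picardLik hρ hα hβ (ha.sum_le u₀ hu) ha.lt_one).sub_const
      (meanLik P Z β α)).abs
    have t3 := t1.add t2
    simp only [zero_mul, mul_zero, sub_self, abs_zero, add_zero] at t3
    exact (t3.eventually_lt_const hε).exists
  set q : ℕ := (m + 1) * p with hq
  -- Rescaled distance from u₀ of any time used: half the window, the `q` steps of Picard memory,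
  -- and one step for rounding u₀N to t₀.
  set r : ℕ → ℝ := fun N => |b N| / 2 + (q + 1 : ℝ) / N with hr
  have hr0 : ∀ N, 0 ≤ r N := fun N => by positivity
  have hrt : Tendsto r atTop (𝓝 0) := by
    have t1 : Tendsto (fun N => |b N| / 2) atTop (𝓝 0) := by simpa using hb.abs.div_const 2
    simpa using t1.add (tendsto_const_div_atTop_nhds_zero_nat (q + 1 : ℝ))
  set ξ : ℕ → S → ℝ := fun k => picardLik α β Z m (k : ℤ) with hξ
  have hξi : ∀ k, Integrable (ξ k) P := fun k => hZ.integrable_picardLik hρ hα hβ m k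
  set c : ℕ → ℕ → ℝ := fun N k => kernelWeight W (b N * N) (t₀ N) k with hc
  have hLLN : Tendsto (fun N => ∫ ω, |∑ k ∈ Finset.Icc (p + 1) N, c N k * ξ k ω -
      ∫ ω, ξ 0 ω ∂P| ∂P) atTop (𝓝 0) := by
    refine tendsto_integral_abs_weighted_sum_sub (C := 4 * Kw) (e := fun N => Kw / (b N * N))
      (fun k => (measurable_picardLik_sig α β Z m k).mono (sig_le hZ.measurable _) le_rfl)
      (fun k => hZ.identDistrib_picardLik α m k) (hξi 0) q (fun k l hkl =>
        hZ.indepFun_picardLik α m (by exact_mod_cast hkl)) _ c ?_ ?_ ?_ ?_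
    · filter_upwards [hbN.eventually_ge_atTop 1] with N hN
      exact sum_abs_kernelWeight_le hKw hKw0.le hN _
    · filter_upwards [hbN.eventually_gt_atTop 0] with N hN
      exact ⟨(div_pos hKw0 hN).le, fun k _ => abs_kernelWeight_le hKw hKw0.le hN⟩
    · exact hbN.const_div_atTop Kw
    · exact tendsto_sum_kernelWeight hW (p + 1) hbN
        (eventually_add_half_le hu₀ ht₀ hb _) (eventually_add_half_le_self hu₀ ht₀ hb)
  refine ⟨fun N => 4 * Kw * (L * (M * (1 + p * K) * (m + 1) * r N)) +
    ∫ ω, |∑ k ∈ Finset.Icc (p + 1) N, c N k * ξ k ω - ∫ ω, ξ 0 ω ∂P| ∂P, ?_, ?_⟩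
  · have t1 := ((hrt.const_mul (M * (1 + p * K) * (m + 1))).const_mul L).const_mul (4 * Kw)
    simpa using t1.add hLLN
  filter_upwards [hbN.eventually_ge_atTop 1, eventually_ge_atTop 1,
    eventually_add_half_le hu₀ ht₀ hb (q + 1)] with N hh hN hleft
  have hh0 : 0 < b N * N := by linarith
  set Q : ℕ → S → ℝ := fun k ω =>
    qlik α (X N k ω ^ 2) fun j => X N (k - ((j : ℤ) + 1)) ω ^ 2 with hQ
  have hQi : ∀ k ∈ Finset.Icc (p + 1) N, Integrable (Q k) P := fun k hk => by
    rw [Finset.mem_Icc] at hk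
    exact integrable_qlik_sq (fun N t x y z => (hK N t x y z).1) hρ hα (by omega) (by omega)
  set E := L * (M * (1 + p * K) * (m + 1) * r N + A ^ m * K) with hE
  have hE0 : 0 ≤ E := by
    have := hr0 N
    positivity
  -- Local approximation is available only inside the window; elsewhere the weight vanishes. The
  -- margin q + 1 keeps all times in the Picard memory at least 1.
  have hdiff : ∀ k ∈ Finset.Icc (p + 1) N, c N k ≠ 0 → ∫ ω, |Q k ω - ξ k ω| ∂P ≤ E := by
    intro k hk hne
    rw [Finset.mem_Icc] at hk
    have hw := abs_sub_le_of_kernelWeight_ne_zero hh0 hne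
    have hkq : q + 1 ≤ k := by
      rw [abs_le] at hw
      have : (q : ℝ) + 1 ≤ k := by linarith [hw.2]
      exact_mod_cast this
    have hqc : ((m + 1 : ℕ) : ℤ) * p = (q : ℤ) := by rw [hq]; push_cast; ring
    refine hX.integral_abs_qlik_sub_picardLik_le hZ ha hK0 hK hu hα (hr0 N) m k ?_ ?_ ?_
    · rw [hqc]; omega
    · exact_mod_cast hk.2
    · rw [hqc]
      exact fun s hs1 hs2 => abs_div_sub_le_of_mem_window ht₀ hN hw hs1 hs2
  have i1 : Integrable (fun ω => ∑ k ∈ Finset.Icc (p + 1) N, c N k * (Q k ω - ξ k ω)) P :=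
    integrable_finsetSum _ fun k hk => ((hQi k hk).sub (hξi k)).const_mul _
  have i2 : Integrable (fun ω => ∑ k ∈ Finset.Icc (p + 1) N, c N k * ξ k ω -
      ∫ ω, ξ 0 ω ∂P) P :=
    (integrable_finsetSum _ fun k _ => (hξi k).const_mul _).sub (integrable_const _)
  have i3 := (integrable_weightedLik (W := W) (fun N t x y z => (hK N t x y z).1) hρ hα (b N)
    (t₀ N) N).sub (integrable_const (meanLik P Z β α))
  have hpt : ∀ ω, |weightedLik W (b N) (t₀ N) (fun n t => X n t ω) N α - meanLik P Z β α| ≤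
      |∑ k ∈ Finset.Icc (p + 1) N, c N k * (Q k ω - ξ k ω)| +
      |∑ k ∈ Finset.Icc (p + 1) N, c N k * ξ k ω - ∫ ω, ξ 0 ω ∂P| +
      |∫ ω, picardLik α β Z m 0 ω ∂P - meanLik P Z β α| := fun ω => by
    have e : weightedLik W (b N) (t₀ N) (fun n t => X n t ω) N α - meanLik P Z β α =
        ∑ k ∈ Finset.Icc (p + 1) N, c N k * (Q k ω - ξ k ω) +
        (∑ k ∈ Finset.Icc (p + 1) N, c N k * ξ k ω - ∫ ω, ξ 0 ω ∂P) +
        (∫ ω, ξ 0 ω ∂P - meanLik P Z β α) := by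
      simp only [weightedLik_eq, quasiLik_eq_qlik, mul_sub, Finset.sum_sub_distrib, hQ, hc]
      ring
    rw [e]
    exact (abs_add_le _ _).trans (add_le_add (abs_add_le _ _) le_rfl)
  refine (integral_le_add_add_const i3.abs i1.abs i2.abs (Eventually.of_forall hpt)).trans ?_
  have b1 : ∫ ω, |∑ k ∈ Finset.Icc (p + 1) N, c N k * (Q k ω - ξ k ω)| ∂P ≤ 4 * Kw * E := by
    refine (integral_abs_sum_le _ (c N) (f := fun k ω => Q k ω - ξ k ω)
      fun k hk => (hQi k hk).sub (hξi k)).trans ?_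
    refine le_trans (Finset.sum_le_sum (g := fun k => |c N k| * E) fun k hk => ?_) ?_
    · by_cases hne : c N k = 0
      · simp [hne]
      · exact mul_le_mul_of_nonneg_left (hdiff k hk hne) (abs_nonneg _)
    · rw [← Finset.sum_mul]
      exact mul_le_mul_of_nonneg_right (sum_abs_kernelWeight_le hKw hKw0.le hh _) hE0
  have b2 : 4 * Kw * E = 4 * Kw * (L * (M * (1 + p * K) * (m + 1) * r N)) +
      4 * Kw * (L * (A ^ m * K)) := by rw [hE]; ring
  linarith

/-- Equicontinuity in the parameter: the random Lipschitz constant has mean bounded in N. Absolute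
weights appear because the kernel may change sign. -/
lemma abs_weightedLik_sub_le {x : ℕ → ℤ → ℝ} {α α' : Fin (p + 1) → ℝ} (hρ : 0 < ρ)
    (hα : ∀ j, α j ∈ Icc ρ R) (hα' : ∀ j, α' j ∈ Icc ρ R) (b : ℝ) (t₀ N : ℕ) :
    |weightedLik W b t₀ x N α - weightedLik W b t₀ x N α'| ≤ lipConst ρ R * dist α α' *
      ∑ k ∈ Finset.Icc (p + 1) N, |kernelWeight W (b * N) t₀ k| * (1 + x N k ^ 2) := by
  rw [weightedLik_eq, weightedLik_eq, ← Finset.sum_sub_distrib, Finset.mul_sum]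
  refine (Finset.abs_sum_le_sum_abs _ _).trans (Finset.sum_le_sum fun k _ => ?_)
  rw [← mul_sub, abs_mul]
  have := abs_qlik_sub_qlik_param_le hρ hα hα'
    (v := fun j : Fin p => x N ((k : ℤ) - ((j : ℤ) + 1)) ^ 2) (fun j => sq_nonneg _)
    (sq_nonneg (x N k)) (δ := dist α α') fun j => by
      rw [← Real.dist_eq]; exact dist_le_pi_dist α α' j
  calc _ ≤ |kernelWeight W (b * N) t₀ k| * (lipConst ρ R * dist α α' * (1 + x N k ^ 2)) :=
        mul_le_mul_of_nonneg_left this (abs_nonneg _)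
    _ = _ := by ring

lemma exists_pos_gap_of_isCompact {E : Type*} [TopologicalSpace E] {s : Set E} {f : E → ℝ}
    {c : ℝ} (hs : IsCompact s) (hf : ContinuousOn f s) (h : ∀ x ∈ s, c < f x) :
    ∃ δ > 0, ∀ x ∈ s, c + δ ≤ f x := by
  rcases s.eq_empty_or_nonempty with rfl | hne
  · exact ⟨1, one_pos, fun x hx => hx.elim⟩
  · obtain ⟨y, hy, hmin⟩ := hs.exists_isMinOn hne hf
    exact ⟨f y - c, sub_pos.2 (h y hy), fun x hx => by linarith [isMinOn_iff.1 hmin x hx]⟩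

end Consistency

end TvARCH

end

/-! ### From uniform control of the contrast to consistency. -/

theorem theorem2 {S : Type*} [MeasurableSpace S] (P : Measure S) [IsProbabilityMeasure P]
    (p : ℕ) (Z : ℤ → S → ℝ) (hZ : TvARCH.IsInnovation P Z)
    (hZ_nondegenerate : ¬ ∀ᵐ ω ∂P, Z 0 ω ^ 2 = 1)
    (a : Fin (p + 1) → ℝ → ℝ) (X : ℕ → ℤ → S → ℝ) (hX : TvARCH.IsTvARCH P Z a X)
    (ha : TvARCH.RegularCoeffs a)
    (ρ₁ ρ₂ : ℝ) (hρ₁ : 0 < ρ₁) (hρ₁₂ : ρ₁ ≤ ρ₂)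
    (ha_int : ∀ u ∈ Ioc (0 : ℝ) 1, (fun j => a j u) ∈ interior (TvARCH.paramSet p ρ₁ ρ₂))
    (W : ℝ → ℝ) (hW : TvARCH.IsKernel W)
    (u₀ : ℝ) (hu₀ : u₀ ∈ Ioo (0 : ℝ) 1)
    (t₀ : ℕ → ℕ) (ht₀ : ∀ N : ℕ, 1 ≤ N → |u₀ - (t₀ N : ℝ) / N| < 1 / N)
    (b : ℕ → ℝ) (hb : Tendsto b atTop (𝓝 0))
    (hbN : Tendsto (fun N : ℕ => b N * N) atTop atTop)
    (aHat : ℕ → S → Fin (p + 1) → ℝ)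
    (haHat : ∀ N : ℕ, 1 ≤ N → ∀ᵐ ω ∂P,
      aHat N ω ∈ TvARCH.paramSet p ρ₁ ρ₂ ∧
      IsMinOn (TvARCH.weightedLik W (b N) (t₀ N) (fun n t => X n t ω) N)
        (TvARCH.paramSet p ρ₁ ρ₂) (aHat N ω)) :
    TendstoInMeasure P aHat atTop (fun _ j => a j u₀) := by
  obtain ⟨A, M, hc⟩ := ha.exists_coeffBounds hρ₁ ha_int
  obtain ⟨K, hK0, hK⟩ := hX.exists_moment_bound hZ hc
  have hu : u₀ ∈ Ioc (0 : ℝ) 1 := ⟨hu₀.1, hu₀.2.le⟩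
  set Ω := TvARCH.paramSet p ρ₁ ρ₂ with hΩ
  set R := max ρ₂ 1 with hR
  have hΩR : ∀ α ∈ Ω, ∀ j, α j ∈ Icc ρ₁ R := fun α h j => TvARCH.mem_Icc_of_mem_paramSet hρ₁ h j
  set β : Fin (p + 1) → ℝ := fun j => a j u₀ with hβdef
  have hβΩ : β ∈ Ω := interior_subset (ha_int u₀ hu)
  have hβ := hΩR β hβΩ
  have hA := hc.sum_le u₀ hu
  have hL := TvARCH.lipConst_pos hρ₁ (TvARCH.upper_pos hρ₁ hβ)
  obtain ⟨Kw, hKw0, hKw⟩ :=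
    TvARCH.exists_abs_le_of_boundedVariationOn hW.boundedVariation
  rw [tendstoInMeasure_iff_measureReal_dist]
  intro ε hε
  set B := Ω ∩ {α | ε ≤ dist α β} with hB
  have hBc : IsCompact B :=
    (TvARCH.isCompact_paramSet p ρ₂ hρ₁).inter_right
      (isClosed_le continuous_const (continuous_id.dist continuous_const))
  have hcont : ContinuousOn (TvARCH.meanLik P Z β) B :=
    (LipschitzOnWith.of_dist_le' fun α hα α' hα' =>
      hZ.abs_meanLik_sub_meanLik_le hρ₁ (hΩR α hα.1) (hΩR α' hα'.1) hβ hA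
        hc.lt_one).continuousOn
  obtain ⟨δ, hδ, hgap⟩ := TvARCH.exists_pos_gap_of_isCompact (c := TvARCH.meanLik P Z β β) hBc
    hcont fun α hα => hZ.meanLik_lt hZ_nondegenerate hρ₁ (hΩR α hα.1) hβ hA hc.lt_one fun h => by
      have : ε ≤ dist α β := hα.2
      rw [h, dist_self] at this
      linarith
  refine TvARCH.tendsto_zero_of_forall_le_add (fun N => measureReal_nonneg) fun τ hτ => ?_
  set C := TvARCH.lipConst ρ₁ R * (4 * Kw * (1 + K)) with hC
  have hC0 : 0 < C := by positivity
  -- The mesh is tuned so that the oscillation of the likelihood between net points contributes at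
  -- most τ after Markov's inequality divides by δ.
  set η := τ * δ / C with hη
  have hη0 : 0 < η := by positivity
  obtain ⟨T, hTB, hTfin, hcover⟩ := finite_cover_balls_of_compact hBc hη0
  set D : ℕ → (Fin (p + 1) → ℝ) → S → ℝ := fun N α ω =>
    |TvARCH.weightedLik W (b N) (t₀ N) (fun n t => X n t ω) N α - TvARCH.meanLik P Z β α| with hD
  have hDi : ∀ N, ∀ α ∈ Ω, Integrable (D N α) P := fun N α hα =>
    ((TvARCH.integrable_weightedLik (fun N t x y z => (hK N t x y z).1) hρ₁ (hΩR α hα) _ _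
      _).sub (integrable_const _)).abs
  have hDt : ∀ α ∈ Ω, Tendsto (fun N => ∫ ω, D N α ω ∂P) atTop (𝓝 0) := fun α hα =>
    hX.tendsto_integral_abs_weightedLik_sub hZ hc hK0 hK hW hu₀ ht₀ hb hbN (hΩR α hα)
  have hTΩ : ∀ α ∈ hTfin.toFinset, α ∈ Ω := fun α hα => (hTB (hTfin.mem_toFinset.1 hα)).1
  refine ⟨fun N => (∑ α ∈ hTfin.toFinset, ∫ ω, D N α ω ∂P + ∫ ω, D N β ω ∂P) / δ, ?_, ?_⟩
  · have h1 : Tendsto (fun N => ∑ α ∈ hTfin.toFinset, ∫ ω, D N α ω ∂P) atTop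
        (𝓝 (∑ _α ∈ hTfin.toFinset, (0 : ℝ))) :=
      tendsto_finsetSum _ fun α hα => hDt α (hTΩ α hα)
    simpa using (h1.add (hDt β hβΩ)).div_const δ
  filter_upwards [hbN.eventually_ge_atTop 1, eventually_ge_atTop 1] with N hh hN
  set w : ℕ → ℝ := fun k => |TvARCH.kernelWeight W (b N * N) (t₀ N) k| with hw
  set V : S → ℝ := fun ω => ∑ k ∈ Finset.Icc (p + 1) N, w k * (1 + X N k ω ^ 2) with hV
  have hXi : ∀ k ∈ Finset.Icc (p + 1) N, Integrable (fun ω => 1 + X N k ω ^ 2) P :=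
    fun k hk => by
      rw [Finset.mem_Icc] at hk
      exact (integrable_const _).add (hK N k hN (by omega) (by omega)).1
  have hVi : Integrable V P := integrable_finsetSum _ fun k hk => (hXi k hk).const_mul _
  have hV0 : ∀ ω, 0 ≤ V ω := fun ω => Finset.sum_nonneg fun k _ => by positivity
  have hVle : ∫ ω, V ω ∂P ≤ 4 * Kw * (1 + K) := by
    rw [integral_finsetSum _ fun k hk => (hXi k hk).const_mul _]
    refine le_trans (Finset.sum_le_sum (g := fun k => w k * (1 + K)) fun k hk => ?_) ?_
    · rw [integral_const_mul]
      refine mul_le_mul_of_nonneg_left ?_ (abs_nonneg _)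
      rw [Finset.mem_Icc] at hk
      obtain ⟨h1, h2⟩ := hK N k hN (by omega) (by omega)
      rw [integral_add (integrable_const _) h1, integral_const, probReal_univ, one_smul]
      linarith
    · rw [← Finset.sum_mul]
      exact mul_le_mul_of_nonneg_right
        (TvARCH.sum_abs_kernelWeight_le hKw hKw0.le hh _) (by linarith)
  -- If the minimizer lies in `B`, let α be a nearby net point. Chaining gap, deviation at α,
  -- oscillation, minimality against β and deviation at β gives δ ≤ F, with F independent of the
  -- minimizer.
  set F : S → ℝ := fun ω => (∑ α ∈ hTfin.toFinset, D N α ω + D N β ω) +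
    TvARCH.lipConst ρ₁ R * η * V ω with hF
  have hsumi : Integrable (fun ω => ∑ α ∈ hTfin.toFinset, D N α ω) P :=
    integrable_finsetSum _ fun α hα => hDi N α (hTΩ α hα)
  have hFi : Integrable F P := (hsumi.add (hDi N β hβΩ)).add (hVi.const_mul _)
  have hD0 : ∀ α ω, 0 ≤ D N α ω := fun α ω => abs_nonneg _
  have hF0 : ∀ ω, 0 ≤ F ω := fun ω =>
    add_nonneg (add_nonneg (Finset.sum_nonneg fun α _ => hD0 α ω) (hD0 β ω))
      (mul_nonneg (by positivity) (hV0 ω))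
  have hsub : ∀ᵐ ω ∂P, ε ≤ dist (aHat N ω) β → δ ≤ F ω := by
    filter_upwards [haHat N hN] with ω hω hdist
    have hmem : aHat N ω ∈ B := ⟨hω.1, hdist⟩
    obtain ⟨α, hαT, hαball⟩ := mem_iUnion₂.1 (hcover hmem)
    have hαB := hTB hαT
    have h1 := TvARCH.abs_weightedLik_sub_le (W := W) (x := fun n t => X n t ω) hρ₁
      (hΩR α hαB.1) (hΩR _ hω.1) (b N) (t₀ N) N
    have h2 : dist α (aHat N ω) ≤ η := by rw [dist_comm]; exact (Metric.mem_ball.1 hαball).le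
    have h3 : TvARCH.lipConst ρ₁ R * dist α (aHat N ω) * V ω ≤
        TvARCH.lipConst ρ₁ R * η * V ω :=
      mul_le_mul_of_nonneg_right (mul_le_mul_of_nonneg_left h2 hL.le) (hV0 ω)
    have h4 := isMinOn_iff.1 hω.2 β hβΩ
    have h5 := hgap α hαB
    have h6 : D N α ω ≤ ∑ α ∈ hTfin.toFinset, D N α ω :=
      Finset.single_le_sum (f := fun α => D N α ω) (fun α _ => hD0 α ω)
        (hTfin.mem_toFinset.2 hαT)
    have h7 := neg_abs_le (TvARCH.weightedLik W (b N) (t₀ N) (fun n t => X n t ω) N α -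
      TvARCH.meanLik P Z β α)
    have h8 := le_abs_self (TvARCH.weightedLik W (b N) (t₀ N) (fun n t => X n t ω) N β -
      TvARCH.meanLik P Z β β)
    have h9 := (le_abs_self _).trans (h1.trans h3)
    simp only [hF]
    simp only [hD] at h6 ⊢
    linarith
  -- The chosen minimizer need not be measurable; monotonicity of the outer measure passes to an
  -- event defined by `F`, to which Markov's inequality applies.
  have hmeas : P.real {ω | ε ≤ dist (aHat N ω) β} ≤ P.real {ω | δ ≤ F ω} :=
    ENNReal.toReal_mono (measure_ne_top _ _) (measure_mono_ae hsub)
  have hmarkov := mul_meas_ge_le_integral_of_nonneg (Eventually.of_forall hF0) hFi δ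
  have hFint : ∫ ω, F ω ∂P = (∑ α ∈ hTfin.toFinset, ∫ ω, D N α ω ∂P + ∫ ω, D N β ω ∂P) +
      TvARCH.lipConst ρ₁ R * η * ∫ ω, V ω ∂P := by
    have e1 := integral_add' (hsumi.add (hDi N β hβΩ)) (hVi.const_mul (TvARCH.lipConst ρ₁ R * η))
    have e2 := integral_add' hsumi (hDi N β hβΩ)
    rw [e2, integral_const_mul, integral_finsetSum _ fun α hα => hDi N α (hTΩ α hα)] at e1
    exact e1
  have hτδ : TvARCH.lipConst ρ₁ R * η * ∫ ω, V ω ∂P ≤ τ * δ := by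
    refine (mul_le_mul_of_nonneg_left hVle (by positivity)).trans_eq ?_
    have : TvARCH.lipConst ρ₁ R * η * (4 * Kw * (1 + K)) = η * C := by rw [hC]; ring
    rw [this, hη, div_mul_cancel₀ _ hC0.ne']
  refine hmeas.trans ?_
  rw [← sub_le_iff_le_add', le_div_iff₀ hδ]
  nlinarith
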